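/- Let $F$ be a field and $F\langle X\rangle$ the free associative (non-commutative) $F$-algebra on countably many variables $X=\{x_1,x_2,\dots\}$. For $m\ge 0$ let $S_m(x_1,\dots,x_m)=\sum_{\sigma\in\mathfrak S_m}\operatorname{sgn}(\sigma)\,x_{\sigma(1)}\cdots x_{\sigma(m)}$. For a sequence $f_1,\dots,f_r\in F\langle X\rangle$ let $Q_{S_{2d}}(f_1,\dots,f_r)$ be the least $k$ for which there are $k$ substitution instances $g_1,\dots,g_k$ of $S_{2d}$ (i.e. $g_j=S_{2d}(h_{j,1},\dots,h_{j,2d})$ with $h_{j,i}\in F\langle X\rangle$) such that every $f_i$ lies in the two-sided ideal generated by $g_1,\dots,g_k$ ($Q_{S_{2d}}=\infty$ if there is no such $k$). An s-polynomial in $x_1,\dots,x_n$ is a polynomial of the form $\sum_{1\le j_1<\dots<j_{2d}\le n} c_{j_1\cdots j_{2d}}\,S_{2d}(x_{j_1},\dots,x_{j_{2d}})$ with all $c_{j_1\cdots j_{2d}}\in\{0,1\}$. An identity of $\mathrm{Mat}_d(F)$ is a polynomial that vanishes under every substitution of $d\times d$ matrices over $F$ for the variables. Let $d\ge 1$. (1)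 If $P_1,\dots,P_n$ are s-polynomials in $x_1,\dots,x_n$, $z_1,\dots,z_n$ are pairwise distinct variables different from $x_1,\dots,x_n$, and $\dot P=\sum_{i=1}^n z_iP_i$, then $$Q_{S_{2d}}(\dot P)\ \ge\ \frac{1}{2d+1}\,Q_{S_{2d}}(P_1,\dots,P_n).$$ (2) There are $c>0$ and $N$, depending only on $d$, such that for every field $F$ of characteristic $0$ and every $n\ge N$ the following hold. (a) There are s-polynomials $P_1,\dots,P_n$ in $x_1,\dots,x_n$ which are identities of $\mathrm{Mat}_d(F)$, with $c\,n^{2d}\le Q_{S_{2d}}(P_1,\dots,P_n)<\infty$, and such that $c\,n^{2d}\le Q_{S_{2d}}(\dot P)<\infty$ for $\dot P=\sum_i z_iP_i$ with any pairwise distinct new variables $z_1,\dots,z_n$. (b) There is also a polynomial of the form $\dot P=\sum_{i=1}^m z_iP_i$, with s-polynomials $P_1,\dots,P_m$ in $x_1,\dots,x_m$ and distinct new variables $z_1,\dots,z_m$, which involves only the $n$ variables $x_1,\dots,x_n$ (the $z_i$ being among $x_{m+1},\dots,x_n$), is an identity of $\mathrm{Mat}_d(F)$, and satisfies $c\,n^{2d}\le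 Q_{S_{2d}}(\dot P)<\infty$. -/

import Mathlib

namespace GenComplexity

/-- The free associative algebra `F⟨X⟩` on the countable set of variables `x₀, x₁, x₂, …`. -/
abbrev NCPoly (F : Type*) [Field F] : Type _ := FreeAlgebra F ℕ

/-- The `i`-th variable. -/
noncomputable def var (F : Type*) [Field F] (i : ℕ) : NCPoly F := FreeAlgebra.ι F i

/-- The value `S_m(a₁, …, a_m) = ∑_σ sgn(σ) a_{σ(1)} ⋯ a_{σ(m)}` of the standard polynomial
(the product is taken in the displayed order). -/
noncomputable def standard {A : Type*} [Ring A] {m : ℕ} (a : Fin m → A) : A :=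
  ∑ σ : Equiv.Perm (Fin m),
    ((Equiv.Perm.sign σ : ℤˣ) : ℤ) • (List.ofFn fun i => a (σ i)).prod

/-- The standard polynomial `S_m` as an element of the free algebra, in its first `m` variables. -/
noncomputable def standardPoly (F : Type*) [Field F] (m : ℕ) : NCPoly F :=
  standard fun i : Fin m => var F i

/-- `f` is an identity of the algebra `A`: it vanishes under all assignments from `A`. -/
def IsIdentity {F : Type*} [Field F] (A : Type*) [Ring A] [Algebra F A] (f : NCPoly F) : Prop :=
  ∀ a : ℕ → A, FreeAlgebra.lift F a f = 0

/-- `g` is a substitution instance of some polynomial of `B`. -/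
def IsSubstInstance {F : Type*} [Field F] (B : Set (NCPoly F)) (g : NCPoly F) : Prop :=
  ∃ h ∈ B, ∃ s : ℕ → NCPoly F, g = FreeAlgebra.lift F s h

/-- All members of the family `f` lie in a two-sided ideal generated by `k` substitution
instances of polynomials of `B`. -/
def GeneratedBy {F : Type*} [Field F] (B : Set (NCPoly F)) {I : Type*} (f : I → NCPoly F)
    (k : ℕ) : Prop :=
  ∃ g : Fin k → NCPoly F, (∀ j, IsSubstInstance B (g j)) ∧
    ∀ i, f i ∈ TwoSidedIdeal.span (Set.range g)

/-- The generative complexity `Q_B(f₁, …, f_n)` of a family: the least number of substitution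
instances of polynomials of `B` that generate all of it (`⊤` if there is no such number). -/
noncomputable def Q {F : Type*} [Field F] (B : Set (NCPoly F)) {I : Type*}
    (f : I → NCPoly F) : ℕ∞ :=
  sInf {q : ℕ∞ | ∃ k : ℕ, q = k ∧ GeneratedBy B f k}

/-- The generative complexity `Q_B(f)` of a single polynomial. -/
noncomputable def Q₁ {F : Type*} [Field F] (B : Set (NCPoly F)) (f : NCPoly F) : ℕ∞ :=
  Q B fun _ : Unit => f

open Classical in
/-- `P` is an s-polynomial in the first `n` variables: a combination with coefficients in `{0, 1}`
of the polynomials `S_{2d}(x_{j₁}, …, x_{j_{2d}})`, `j₁ < ⋯ < j_{2d}`. -/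
def IsSPolynomial {F : Type*} [Field F] (d n : ℕ) (P : NCPoly F) : Prop :=
  ∃ c : (Fin (2 * d) → Fin n) → F, (∀ j, c j = 0 ∨ c j = 1) ∧
    P = ∑ j : Fin (2 * d) → Fin n with StrictMono j,
      c j • standard fun k => var F (j k : ℕ)

/-- The variables with indices `z i` are pairwise distinct and differ from the first `n` ones. -/
def IsNewVars (n : ℕ) (z : Fin n → ℕ) : Prop :=
  Function.Injective z ∧ ∀ i, n ≤ z i

/-- The polynomial `∑ z_i P_i`, where `z_i` is the variable with index `z i`. -/
noncomputable def combine {F : Type*} [Field F] {n : ℕ} (z : Fin n → ℕ) (P : Fin n → NCPoly F) :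
    NCPoly F :=
  ∑ i, var F (z i) * P i

end GenComplexity

/-! Lower bound for `combine z P`. A trace here is an additive map τ with τ(ab) = τ(ba). Since
S_{2d} vanishes as soon as one argument is 1, constant terms of the arguments do not matter, and the
lowest component of a value S(h) is S(ℓ), in degree 2d, with ℓ the linear parts of h. Suppose ∑ z_i
P_i lies in the ideal generated by k values, and apply a trace to its component of degree 2d+1.
Traces kill values of S_{2d}, so only products e·S(ℓ) survive, with one linear form e per generator
(`exists_trace_coeff_grade_eq`). The cyclic derivative in z_i, with the other new variables set to
0, is such a trace and recovers P_i. Because a trace lets e change places with an argument of S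
(`trace_mul_standard`), it turns e·S(ℓ) into a combination of S(ℓ') and of the 2d values in which e'
replaces one entry of ℓ', where the prime removes the new variables. These 2d+1 values do not depend
on i, so (2d+1)k values generate all the P_i (`generatedBy_of_combine`).

Lower bound for sequences. Families of n s-polynomials correspond to subsets of a set T of size
n·C(n,2d). If k values always sufficed, the degree-2d components would make every 0/1 vector indexed
by T a value of one polynomial map of degree 2d+1 in n(2d+1)k parameters. The indicators of the
subsets are then linearly independent functions spanned by few monomials, so 2^|T| is at most a
number of monomials, which forces k ≥ const·C(n,2d) (`pow_card_le_pow_card`, `exists_sFamily_hard`).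
This holds over any field.

Characteristic 0 enters only through the Amitsur-Levitzki theorem, proved by Rosset's argument: the
matrix M = ∑ a_i e_i over an exterior algebra has M^{2d} = S_{2d}(a) e_1∧⋯∧e_{2d}, while M² has
commuting entries and powers of trace zero, hence (M²)^d = 0. -/

namespace GenComplexity


/-! ### Standard polynomials: expansion and vanishing at 1 -/

section Standard

variable {A : Type*} [Ring A]

/-- The standard polynomial as an alternating map. -/
noncomputable def standardAlt (R A : Type*) [CommRing R] [Ring A] [Algebra R A] (m : ℕ) :
    A [⋀^Fin m]→ₗ[R] A :=
  MultilinearMap.alternatization (MultilinearMap.mkPiAlgebraFin R m A)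

theorem standardAlt_apply (R : Type*) [CommRing R] [Algebra R A] {m : ℕ} (a : Fin m → A) :
    standardAlt R A m a = standard a := by
  simp [standardAlt, standard, MultilinearMap.alternatization_apply, Units.smul_def]

theorem map_standard {B H : Type*} [Ring B] [FunLike H A B] [RingHomClass H A B] (f : H) {m : ℕ}
    (a : Fin m → A) : f (standard a) = standard fun i => f (a i) := by
  simp only [standard, map_sum, map_zsmul, map_list_prod, List.map_ofFn]
  rfl

/-- Expansion of an alternating map at a family that is shifted along a single vector. -/
theorem alternatingMap_add_smul {R M N ι : Type*} [CommRing R] [AddCommGroup M] [Module R M]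
    [AddCommGroup N] [Module R N] [Fintype ι] [DecidableEq ι] (f : M [⋀^ι]→ₗ[R] N)
    (v : ι → M) (c : ι → R) (z : M) :
    f (fun i => v i + c i • z) = f v + ∑ i, c i • f (Function.update v i z) := by
  -- The coordinates are shifted one at a time; a term with z in two slots vanishes.
  have key : ∀ s : Finset ι, f (fun i => v i + (if i ∈ s then c i else 0) • z) =
      f v + ∑ i ∈ s, c i • f (Function.update v i z) := by
    intro s
    induction s using Finset.induction_on with
    | empty => simp
    | insert k s hk ih =>
      have hz : ∀ t : Finset ι, k ∉ t →
          f (Function.update (fun i => v i + (if i ∈ t then c i else 0) • z) k z) =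
            f (Function.update v k z) := by
        intro t
        induction t using Finset.induction_on with
        | empty => simp
        | insert l t hl iht =>
          intro hkt
          have hkl : k ≠ l := fun h => hkt (h ▸ Finset.mem_insert_self _ _)
          have hkt' : k ∉ t := fun h => hkt (Finset.mem_insert_of_mem h)
          rw [← iht hkt']
          have e1 : Function.update (fun i => v i + (if i ∈ insert l t then c i else 0) • z) k z =
              Function.update (Function.update
                (fun i => v i + (if i ∈ t then c i else 0) • z) k z) l (v l + c l • z) := by
            ext i
            by_cases hi : i = l
            · subst hi; simp [Function.update_of_ne hkl.symm]
            · by_cases hi' : i = k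
              · subst hi'; simp [hi]
              · simp [hi, hi']
          have e2 : Function.update (Function.update
                (fun i => v i + (if i ∈ t then c i else 0) • z) k z) l (v l) =
              Function.update (fun i => v i + (if i ∈ t then c i else 0) • z) k z := by
            ext i
            by_cases hi : i = l
            · subst hi; simp [Function.update_of_ne hkl.symm, hl]
            · simp [hi]
          have e3 : f (Function.update (Function.update
                (fun i => v i + (if i ∈ t then c i else 0) • z) k z) l z) = 0 :=
            f.map_eq_zero_of_eq _ (by simp [Function.update_of_ne hkl]) hkl
          rw [e1, f.map_update_add, f.map_update_smul, e2, e3, smul_zero, add_zero]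
      have e1 : (fun i => v i + (if i ∈ insert k s then c i else 0) • z) =
          Function.update (fun i => v i + (if i ∈ s then c i else 0) • z) k (v k + c k • z) := by
        ext i
        by_cases hi : i = k
        · subst hi; simp
        · simp [hi]
      have e2 : Function.update (fun i => v i + (if i ∈ s then c i else 0) • z) k (v k) =
          fun i => v i + (if i ∈ s then c i else 0) • z := by
        ext i
        by_cases hi : i = k
        · subst hi; simp [hk]
        · simp [hi]
      rw [e1, f.map_update_add, f.map_update_smul, e2, ih, hz s hk, Finset.sum_insert hk]
      abel
  simpa using key Finset.univ

theorem standard_add_smul {R : Type*} [CommRing R] [Algebra R A] {m : ℕ} (v : Fin m → A)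
    (c : Fin m → R) (z : A) :
    standard (fun i => v i + c i • z) =
      standard v + ∑ i, c i • standard (Function.update v i z) := by
  simpa only [standardAlt_apply] using alternatingMap_add_smul (standardAlt R A m) v c z

theorem sum_perm_filter_apply_zero {M : Type*} [AddCommMonoid M] {m : ℕ} (k : Fin (m + 1))
    (f : Equiv.Perm (Fin (m + 1)) → M) :
    ∑ σ : Equiv.Perm (Fin (m + 1)) with σ 0 = k, f σ =
      ∑ e : Equiv.Perm (Fin m), f (Equiv.Perm.decomposeFin.symm (k, e)) := by
  rw [Finset.sum_filter, ← Equiv.Perm.decomposeFin.symm.sum_comp, Fintype.sum_prod_type]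
  simp only [Equiv.Perm.decomposeFin_symm_apply_zero]
  rw [Finset.sum_eq_single k]
  · simp
  · intro b _ hb; simp [hb]
  · simp

/-- `decomposeFin` writes a permutation with σ 0 = j+1 as the transposition (0, j+1) after one
fixing 0, so the remaining factors of the monomial come from `a` with its j-th entry replaced by
`x`. -/
theorem cons_swap_succ {B : Type*} {m : ℕ} (x : B) (a : Fin m → B) (j i : Fin m) :
    (Fin.cons x a : Fin (m + 1) → B) (Equiv.swap 0 j.succ i.succ) = Function.update a j x i := by
  by_cases h : i = j
  · subst h; simp
  · rw [Equiv.swap_apply_of_ne_of_ne (Fin.succ_ne_zero _) (by simpa using h)]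
    simp [h]

theorem sum_perm_apply_zero_eq_zero {m : ℕ} (x : A) (a : Fin m → A) :
    ∑ σ : Equiv.Perm (Fin (m + 1)) with σ 0 = 0,
      ((Equiv.Perm.sign σ : ℤˣ) : ℤ) •
        (List.ofFn fun i => (Fin.cons x a : Fin (m + 1) → A) (σ i)).prod = x * standard a := by
  rw [sum_perm_filter_apply_zero]
  simp only [standard, Finset.mul_sum, List.ofFn_succ, List.prod_cons,
    Equiv.Perm.decomposeFin_symm_apply_zero, Equiv.Perm.decomposeFin_symm_apply_succ,
    Equiv.Perm.decomposeFin.symm_sign, mul_smul_comm]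
  simp

theorem sum_perm_apply_zero_eq_succ {m : ℕ} (x : A) (a : Fin m → A) (j : Fin m) :
    ∑ σ : Equiv.Perm (Fin (m + 1)) with σ 0 = j.succ,
      ((Equiv.Perm.sign σ : ℤˣ) : ℤ) •
        (List.ofFn fun i => (Fin.cons x a : Fin (m + 1) → A) (σ i)).prod =
      -(a j * standard (Function.update a j x)) := by
  rw [sum_perm_filter_apply_zero]
  simp only [standard, Finset.mul_sum, List.ofFn_succ, List.prod_cons,
    Equiv.Perm.decomposeFin_symm_apply_zero, Equiv.Perm.decomposeFin_symm_apply_succ,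
    Equiv.Perm.decomposeFin.symm_sign, cons_swap_succ, mul_smul_comm]
  simp

/-- Expansion of the standard polynomial by the first factor of its monomials. -/
theorem standard_cons {m : ℕ} (x : A) (a : Fin m → A) :
    standard (Fin.cons x a : Fin (m + 1) → A) =
      x * standard a - ∑ j, a j * standard (Function.update a j x) := by
  have h : standard (Fin.cons x a : Fin (m + 1) → A) = ∑ k : Fin (m + 1),
      ∑ σ : Equiv.Perm (Fin (m + 1)) with σ 0 = k, ((Equiv.Perm.sign σ : ℤˣ) : ℤ) •
        (List.ofFn fun i => (Fin.cons x a : Fin (m + 1) → A) (σ i)).prod :=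
    (Finset.sum_fiberwise Finset.univ (fun σ : Equiv.Perm (Fin (m + 1)) => σ 0) _).symm
  rw [h, Fin.sum_univ_succ, sum_perm_apply_zero_eq_zero]
  simp only [sum_perm_apply_zero_eq_succ, Finset.sum_neg_distrib, sub_eq_add_neg]

/-- A transposition brings `x` to the front, where `standard_cons` and the induction hypothesis
below apply. -/
theorem standard_update_eq_neg {m : ℕ} (x : A) (a : Fin (m + 1) → A) (j : Fin m) :
    standard (Function.update a j.succ x) =
      -standard (Fin.cons x (Function.update (Fin.tail a) j (a 0)) : Fin (m + 1) → A) := by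
  have := (standardAlt ℤ A (m + 1)).map_swap (Function.update a j.succ x)
    (Fin.succ_ne_zero j).symm
  rw [standardAlt_apply, standardAlt_apply] at this
  rw [← neg_eq_iff_eq_neg, ← this]
  congr 1
  ext i
  refine Fin.cases ?_ (fun i => ?_) i
  · simp
  · by_cases h : i = j
    · subst h; simp [Function.update_of_ne (Fin.succ_ne_zero i).symm]
    · rw [Function.comp, Equiv.swap_apply_of_ne_of_ne (Fin.succ_ne_zero _) (by simpa using h)]
      simp [h, Fin.tail]

/-- Both parities are proved in one induction through the first-factor expansion: vanishing in even
degree leaves a single term in the next odd degree, and the odd formula makes the next even case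
cancel. -/
theorem standard_one_even_odd (q : ℕ) :
    (∀ (a : Fin (2 * q) → A) (k : Fin (2 * q)), standard (Function.update a k 1) = 0) ∧
      ∀ a : Fin (2 * q) → A, standard (Fin.cons 1 a : Fin (2 * q + 1) → A) = standard a := by
  have odd_of_even : ∀ m : ℕ,
      (∀ (a : Fin m → A) (k : Fin m), standard (Function.update a k 1) = 0) →
      ∀ a : Fin m → A, standard (Fin.cons 1 a : Fin (m + 1) → A) = standard a := by
    intro m h a
    simp [standard_cons, h]
  induction q with
  | zero => exact ⟨fun a k => k.elim0, odd_of_even 0 fun a k => k.elim0⟩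
  | succ q ih =>
    have hcons : ∀ b : Fin (2 * q + 1) → A,
        standard (Fin.cons 1 b : Fin (2 * q + 1 + 1) → A) = 0 := by
      intro b
      rw [standard_cons, one_mul, sub_eq_zero, Fin.sum_univ_succ]
      have h0 : Function.update b 0 1 = (Fin.cons 1 (Fin.tail b) : Fin (2 * q + 1) → A) := by
        ext i
        refine Fin.cases ?_ (fun i => ?_) i
        · simp
        · simp [Fin.tail]
      rw [h0, ih.2]
      simp only [standard_update_eq_neg, ih.2]
      -- The sum that remains is the first-factor expansion of `standard b` itself.
      conv_lhs => rw [← Fin.cons_self_tail b, standard_cons]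
      simp [sub_eq_add_neg, Fin.tail]
    have heven : ∀ (a : Fin (2 * q + 1 + 1) → A) (k : Fin (2 * q + 1 + 1)),
        standard (Function.update a k 1) = 0 := by
      intro a k
      refine Fin.cases ?_ (fun j => ?_) k
      · rw [← hcons (Fin.tail a)]
        congr 1
        ext i
        refine Fin.cases ?_ (fun i => ?_) i
        · simp
        · simp [Fin.tail]
      · rw [standard_update_eq_neg, hcons, neg_zero]
    exact ⟨heven, odd_of_even _ heven⟩

/-- The standard polynomial of even degree vanishes if one of its arguments is `1`. -/
theorem standard_update_one {q : ℕ} (a : Fin (2 * q) → A) (k : Fin (2 * q)) :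
    standard (Function.update a k 1) = 0 :=
  (standard_one_even_odd q).1 a k

theorem standard_add_algebraMap {R : Type*} [CommRing R] [Algebra R A] {q : ℕ}
    (v : Fin (2 * q) → A) (c : Fin (2 * q) → R) :
    standard (fun i => v i + algebraMap R A (c i)) = standard v := by
  simp only [Algebra.algebraMap_eq_smul_one, standard_add_smul, standard_update_one]
  simp

end Standard

/-! ### Traces of standard polynomials -/

section Trace

variable {A V : Type*} [Ring A] [AddCommGroup V]

theorem trace_prod_rotate (τ : A →+ V) (hτ : ∀ a b, τ (a * b) = τ (b * a))
    (l : List A) (j : ℕ) : τ (l.rotate j).prod = τ l.prod := by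
  induction j generalizing l with
  | zero => simp
  | succ j ih =>
    cases l with
    | nil => simp
    | cons x l => rw [List.rotate_cons_succ, ih]; simp [hτ x l.prod]

theorem trace_prod_ofFn_add (τ : A →+ V) (hτ : ∀ a b, τ (a * b) = τ (b * a))
    {m : ℕ} (f : Fin (m + 1) → A) (j : Fin (m + 1)) :
    τ (List.ofFn fun i => f (i + j)).prod = τ (List.ofFn f).prod := by
  rw [← trace_prod_rotate τ hτ (List.ofFn f) j]
  congr 2
  apply List.ext_getElem
  · simp
  · intro i h1 h2
    simp only [List.getElem_ofFn, List.getElem_rotate]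
    congr 1
    ext
    simp [Fin.val_add]

/-- The rotation has odd order, and a sign with an odd power equal to 1 is 1. Hence cyclic rotation
of the monomials of a standard polynomial of odd degree preserves their signs. -/
theorem sign_addRight {q : ℕ} (j : Fin (2 * q + 1)) :
    Equiv.Perm.sign (Equiv.addRight j) = 1 := by
  have h : (Equiv.addRight j) ^ (2 * q + 1) = (1 : Equiv.Perm (Fin (2 * q + 1))) := by
    have hp : ∀ (n : ℕ) (i : Fin (2 * q + 1)), ((Equiv.addRight j) ^ n) i = i + n • j := by
      intro n
      induction n with
      | zero => simp
      | succ n ih => intro i; rw [pow_succ', Equiv.Perm.mul_apply, ih, succ_nsmul]; simp [add_assoc]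
    ext i
    have h0 : (2 * q + 1) • j = 0 := by
      simpa using card_nsmul_eq_zero (G := Fin (2 * q + 1)) (x := j)
    rw [hp, h0]
    simp
  have h2 := congrArg Equiv.Perm.sign h
  rw [map_pow, map_one, pow_succ, pow_mul, Int.units_sq, one_pow, one_mul] at h2
  exact h2

/-- Under a trace, the first factor of `x * S(a)` may be exchanged with an argument of `S`. -/
theorem trace_mul_standard (τ : A →+ V) (hτ : ∀ a b, τ (a * b) = τ (b * a))
    {q : ℕ} (x : A) (a : Fin (2 * q) → A) (k : Fin (2 * q)) :
    τ (x * standard a) = -τ (a k * standard (Function.update a k x)) := by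
  rw [← sum_perm_apply_zero_eq_zero, ← map_neg, ← sum_perm_apply_zero_eq_succ, map_sum, map_sum]
  -- Each monomial is rotated until `a k` stands first; the inverse rotates `x` back to the front.
  refine Finset.sum_bij' (fun σ _ => σ * Equiv.addRight (σ⁻¹ k.succ))
    (fun σ _ => σ * Equiv.addRight (σ⁻¹ 0)) ?_ ?_ ?_ ?_ ?_
  · intro σ _; simp
  · intro σ _; simp
  · intro σ hσ
    have : σ 0 = 0 := by simpa using hσ
    have h2 : σ⁻¹ 0 = 0 := by rw [Equiv.Perm.inv_eq_iff_eq, this]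
    ext i
    simp [mul_inv_rev, h2, add_assoc, Equiv.Perm.mul_apply]
  · intro σ hσ
    have : σ 0 = k.succ := by simpa using hσ
    have h2 : σ⁻¹ k.succ = 0 := by rw [Equiv.Perm.inv_eq_iff_eq, this]
    ext i
    simp [mul_inv_rev, h2, add_assoc, Equiv.Perm.mul_apply]
  · intro σ _
    rw [map_zsmul, map_zsmul, Equiv.Perm.sign_mul, sign_addRight, mul_one]
    congr 1
    exact (trace_prod_ofFn_add τ hτ (fun i => (Fin.cons x a : Fin (2 * q + 1) → A) (σ i)) _).symm

/-- Traces vanish on the values of the standard polynomials of positive even degree. -/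
theorem trace_standard (τ : A →+ V) (hτ : ∀ a b, τ (a * b) = τ (b * a))
    {q : ℕ} (hq : 1 ≤ q) (a : Fin (2 * q) → A) : τ (standard a) = 0 := by
  -- With first factor 1, the exchange puts 1 among the arguments of S.
  have := trace_mul_standard τ hτ 1 a ⟨0, by omega⟩
  rwa [standard_update_one, one_mul, mul_zero, map_zero, neg_zero] at this

end Trace


/-! ### Monomials, restriction of variables and the cyclic derivative -/

section Words

variable (F : Type*) [Field F]

/-- The monomial spelled by a list of variables. -/
noncomputable def word (w : List ℕ) : NCPoly F := (w.map (var F)).prod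

theorem word_nil : word F [] = 1 := rfl

theorem word_cons (v : ℕ) (w : List ℕ) : word F (v :: w) = var F v * word F w := by
  simp [word]

theorem word_append (u w : List ℕ) : word F (u ++ w) = word F u * word F w := by
  simp [word]

theorem basisFreeMonoid_eq_word (w : FreeMonoid ℕ) :
    FreeAlgebra.basisFreeMonoid F ℕ w = word F w.toList := by
  simp [FreeAlgebra.basisFreeMonoid, FreeAlgebra.equivMonoidAlgebraFreeMonoid, word,
    FreeMonoid.lift_apply]
  rfl

variable {F}

theorem linearMap_ext_word {V : Type*} [AddCommGroup V] [Module F V] {f g : NCPoly F →ₗ[F] V}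
    (h : ∀ w : List ℕ, f (word F w) = g (word F w)) : f = g :=
  (FreeAlgebra.basisFreeMonoid F ℕ).ext fun w => by
    rw [basisFreeMonoid_eq_word]; exact h _

/-- The linear map with given values on the monomials. -/
noncomputable def wordLift {V : Type*} [AddCommGroup V] [Module F V] (c : List ℕ → V) :
    NCPoly F →ₗ[F] V :=
  (FreeAlgebra.basisFreeMonoid F ℕ).constr F fun w => c w.toList

theorem wordLift_word {V : Type*} [AddCommGroup V] [Module F V] (c : List ℕ → V) (w : List ℕ) :
    wordLift c (word F w) = c w := by
  have := (FreeAlgebra.basisFreeMonoid F ℕ).constr_basis F (fun w => c w.toList)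
    (FreeMonoid.ofList w)
  rw [basisFreeMonoid_eq_word] at this
  simpa [wordLift] using this

/-- The endomorphism which fixes the variables satisfying `p` and maps the others to `0`. -/
noncomputable def restrictVars (F : Type*) [Field F] (p : ℕ → Prop) [DecidablePred p] :
    NCPoly F →ₐ[F] NCPoly F :=
  FreeAlgebra.lift F fun v => if p v then var F v else 0

theorem restrictVars_var (p : ℕ → Prop) [DecidablePred p] (v : ℕ) :
    restrictVars F p (var F v) = if p v then var F v else 0 := by
  simp [restrictVars, var]

theorem restrictVars_word_of_forall {p : ℕ → Prop} [DecidablePred p] {w : List ℕ}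
    (h : ∀ v ∈ w, p v) : restrictVars F p (word F w) = word F w := by
  induction w with
  | nil => simp [word_nil]
  | cons v w ih =>
    simp only [List.mem_cons, forall_eq_or_imp] at h
    rw [word_cons, map_mul, ih h.2, restrictVars_var, if_pos h.1]

theorem restrictVars_word_of_mem {p : ℕ → Prop} [DecidablePred p] {w : List ℕ} {v : ℕ}
    (hv : v ∈ w) (h : ¬ p v) : restrictVars F p (word F w) = 0 := by
  induction w with
  | nil => simp at hv
  | cons u w ih =>
    rw [word_cons, map_mul]
    rcases List.mem_cons.1 hv with rfl | hv
    · rw [restrictVars_var, if_neg h, zero_mul]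
    · rw [ih hv, mul_zero]

/-- The part of degree one of the cyclic derivative with respect to the variable `z`: a monomial
`u z w`, with `z` not occurring in `u` and `w`, is mapped to `w u`, all others to `0`. -/
noncomputable def cyclicDeriv (F : Type*) [Field F] (z : ℕ) : NCPoly F →ₗ[F] NCPoly F :=
  wordLift fun w => if w.count z = 1 then word F (w.rotate (w.idxOf z)).tail else 0

theorem cyclicDeriv_word_of_count_ne {z : ℕ} {w : List ℕ} (h : w.count z ≠ 1) :
    cyclicDeriv F z (word F w) = 0 := by
  rw [cyclicDeriv, wordLift_word, if_neg h]

theorem cyclicDeriv_word {z : ℕ} {u w : List ℕ} (hu : z ∉ u) (hw : z ∉ w) :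
    cyclicDeriv F z (word F (u ++ z :: w)) = word F (w ++ u) := by
  have hc : (u ++ z :: w).count z = 1 := by
    simp [List.count_eq_zero.2 hu, List.count_eq_zero.2 hw]
  have hi : (u ++ z :: w).idxOf z = u.length := by
    simp [List.idxOf_append, hu]
  rw [cyclicDeriv, wordLift_word, if_pos hc, hi, List.rotate_append_length_eq]
  simp

/-- The derivative reads the word around a circle, starting after its only z, and so depends on the
cyclic word alone. This makes `cyclicDeriv` a trace. -/
theorem cyclicDeriv_word_append_comm (z : ℕ) (u w : List ℕ) :
    cyclicDeriv F z (word F (u ++ w)) = cyclicDeriv F z (word F (w ++ u)) := by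
  have key : ∀ u w : List ℕ, u.count z = 1 → w.count z = 0 →
      cyclicDeriv F z (word F (u ++ w)) = cyclicDeriv F z (word F (w ++ u)) := by
    intro u w hu hw
    rw [List.count_eq_zero] at hw
    obtain ⟨a, b, rfl⟩ := List.append_of_mem (List.count_pos_iff.1 (hu ▸ Nat.one_pos))
    have hab : a.count z = 0 ∧ b.count z = 0 := by
      simp at hu; omega
    rw [List.count_eq_zero, List.count_eq_zero] at hab
    rw [List.append_assoc, List.cons_append, ← List.append_assoc w,
      cyclicDeriv_word hab.1 (by simp [hab.2, hw]), cyclicDeriv_word (by simp [hab.1, hw]) hab.2,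
      List.append_assoc]
  by_cases h : (u ++ w).count z = 1
  · rw [List.count_append] at h
    rcases (by omega : u.count z = 1 ∧ w.count z = 0 ∨ w.count z = 1 ∧ u.count z = 0) with h | h
    · exact key u w h.1 h.2
    · exact (key w u h.1 h.2).symm
  · rw [cyclicDeriv_word_of_count_ne h, cyclicDeriv_word_of_count_ne]
    rw [List.count_append] at h ⊢
    omega

theorem cyclicDeriv_mul_comm (z : ℕ) (f g : NCPoly F) :
    cyclicDeriv F z (f * g) = cyclicDeriv F z (g * f) := by
  have : (LinearMap.mul F (NCPoly F)).compr₂ (cyclicDeriv F z) =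
      (LinearMap.mul F (NCPoly F)).flip.compr₂ (cyclicDeriv F z) := by
    refine linearMap_ext_word fun u => linearMap_ext_word fun w => ?_
    simpa [word_append] using cyclicDeriv_word_append_comm (F := F) z u w
  exact LinearMap.congr_fun₂ this f g

theorem cyclicDeriv_var_mul (z : ℕ) (f : NCPoly F) :
    cyclicDeriv F z (var F z * f) = restrictVars F (· ≠ z) f := by
  have : (cyclicDeriv F z) ∘ₗ (LinearMap.mulLeft F (var F z)) =
      (restrictVars F (· ≠ z)).toLinearMap := by
    refine linearMap_ext_word fun w => ?_
    simp only [LinearMap.comp_apply, LinearMap.mulLeft_apply, AlgHom.toLinearMap_apply,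
      ← word_cons]
    by_cases h : z ∈ w
    · rw [restrictVars_word_of_mem h (by simp), cyclicDeriv_word_of_count_ne]
      have := List.count_pos_iff.2 h
      simp; omega
    · rw [restrictVars_word_of_forall fun v hv => by rintro rfl; exact h hv]
      simpa using cyclicDeriv_word (F := F) (u := []) (by simp) h
  exact LinearMap.congr_fun this f

theorem cyclicDeriv_restrictVars (z : ℕ) (f : NCPoly F) :
    cyclicDeriv F z (restrictVars F (· ≠ z) f) = 0 := by
  have : (cyclicDeriv F z) ∘ₗ (restrictVars F (· ≠ z)).toLinearMap = 0 := by
    refine linearMap_ext_word fun w => ?_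
    simp only [LinearMap.comp_apply, AlgHom.toLinearMap_apply, LinearMap.zero_apply]
    by_cases h : z ∈ w
    · rw [restrictVars_word_of_mem h (by simp), map_zero]
    · rw [restrictVars_word_of_forall fun v hv => by rintro rfl; exact h hv,
        cyclicDeriv_word_of_count_ne]
      simp [List.count_eq_zero.2 h]
  exact LinearMap.congr_fun this f

end Words

/-! ### The grading by degree and linear parts -/

section Grading

open Polynomial

variable {F : Type*} [Field F]

/-- The homogenization: every variable is multiplied by an indeterminate. -/
noncomputable def grade (F : Type*) [Field F] : NCPoly F →ₐ[F] (NCPoly F)[X] :=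
  FreeAlgebra.lift F fun v => C (var F v) * X

theorem grade_var (v : ℕ) : grade F (var F v) = C (var F v) * X := by simp [grade, var]

/-- The linear form with given coefficients. -/
noncomputable abbrev linForm (F : Type*) [Field F] : (ℕ →₀ F) →ₗ[F] NCPoly F :=
  Finsupp.linearCombination F (var F)

theorem coeff_zero_grade (f : NCPoly F) :
    (grade F f).coeff 0 = algebraMap F (NCPoly F) (FreeAlgebra.algebraMapInv f) := by
  induction f using FreeAlgebra.induction with
  | grade0 r => simp [FreeAlgebra.algebraMap_leftInverse r]
  | grade1 v =>
    have := grade_var (F := F) v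
    rw [var] at this
    simp [this, FreeAlgebra.algebraMapInv]
  | mul a b ha hb => rw [map_mul, mul_coeff_zero, ha, hb, map_mul, map_mul]
  | add a b ha hb => rw [map_add, coeff_add, ha, hb, map_add, map_add]

theorem exists_coeff_one_grade (f : NCPoly F) :
    ∃ c : ℕ →₀ F, (grade F f).coeff 1 = linForm F c := by
  induction f using FreeAlgebra.induction with
  | grade0 r => exact ⟨0, by simp⟩
  | grade1 v =>
    have := grade_var (F := F) v
    rw [var] at this
    exact ⟨Finsupp.single v 1, by simp [this, var]⟩
  | mul a b ha hb =>
    obtain ⟨c, hc⟩ := ha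
    obtain ⟨e, he⟩ := hb
    refine ⟨FreeAlgebra.algebraMapInv a • e + FreeAlgebra.algebraMapInv b • c, ?_⟩
    rw [map_mul, coeff_mul, Finset.Nat.antidiagonal_succ]
    simp only [Finset.Nat.antidiagonal_zero, Finset.sum_cons, Finset.map_singleton,
      Finset.sum_singleton, Function.Embedding.prodMap, Function.Embedding.coeFn_mk, Prod.map,
      Function.Embedding.refl_apply, Nat.succ_eq_add_one, zero_add]
    rw [coeff_zero_grade, coeff_zero_grade, hc, he, map_add, map_smul, map_smul,
      Algebra.smul_def, Algebra.smul_def, Algebra.commutes (FreeAlgebra.algebraMapInv b)]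
  | add a b ha hb =>
    obtain ⟨c, hc⟩ := ha
    obtain ⟨e, he⟩ := hb
    exact ⟨c + e, by rw [map_add, coeff_add, hc, he, map_add]⟩

/-- The coefficients of the linear part of a polynomial. -/
noncomputable def linCoeff (f : NCPoly F) : ℕ →₀ F := (exists_coeff_one_grade f).choose

theorem coeff_one_grade (f : NCPoly F) : (grade F f).coeff 1 = linForm F (linCoeff f) :=
  (exists_coeff_one_grade f).choose_spec

theorem prod_ofFn_mul_X {A : Type*} [Ring A] {m : ℕ} (p : Fin m → A[X]) :
    (List.ofFn fun i => p i * X).prod = (List.ofFn p).prod * X ^ m := by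
  induction m with
  | zero => simp
  | succ m ih =>
    rw [List.ofFn_succ, List.prod_cons, ih, List.ofFn_succ, List.prod_cons, pow_succ']
    simp only [mul_assoc]
    rw [← mul_assoc X, X_mul, mul_assoc]

theorem standard_mul_X {A : Type*} [Ring A] {m : ℕ} (p : Fin m → A[X]) :
    standard (fun i => p i * X) = standard p * X ^ m := by
  simp only [standard, Finset.sum_mul, smul_mul_assoc]
  exact Finset.sum_congr rfl fun σ _ => by rw [prod_ofFn_mul_X fun i => p (σ i)]

/-- Constant terms of the arguments may be dropped, after which each argument is divisible by the
central X. -/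
theorem exists_grade_standard {q : ℕ} (h : Fin (2 * q) → NCPoly F) :
    ∃ p : (NCPoly F)[X], grade F (standard h) = p * X ^ (2 * q) ∧
      p.coeff 0 = standard fun i => linForm F (linCoeff (h i)) := by
  have hh : ∀ i, grade F (h i) = (grade F (h i)).divX * X +
      algebraMap F (NCPoly F)[X] (FreeAlgebra.algebraMapInv (h i)) := by
    intro i
    conv_lhs => rw [← (grade F (h i)).divX_mul_X_add, coeff_zero_grade]
    rfl
  refine ⟨standard fun i => (grade F (h i)).divX, ?_, ?_⟩
  · rw [map_standard, ← standard_mul_X]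
    conv_lhs => arg 1; ext i; rw [hh]
    rw [standard_add_algebraMap]
  · have := map_standard (constantCoeff : (NCPoly F)[X] →+* NCPoly F)
      (fun i => (grade F (h i)).divX)
    simpa [coeff_divX, coeff_one_grade] using this

theorem grade_standard_linForm {m : ℕ} (c : Fin m → ℕ →₀ F) :
    grade F (standard fun i => linForm F (c i)) =
      C (standard fun i => linForm F (c i)) * X ^ m := by
  have hl : ∀ e : ℕ →₀ F, grade F (linForm F e) = C (linForm F e) * X := by
    intro e
    simp only [Finsupp.linearCombination_apply, Finsupp.sum, map_sum, Finset.sum_mul]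
    refine Finset.sum_congr rfl fun v _ => ?_
    rw [map_smul, grade_var, ← smul_C, smul_mul_assoc]
  rw [map_standard, map_standard (C : NCPoly F →+* (NCPoly F)[X]), ← standard_mul_X]
  simp only [hl]

end Grading


/-! ### Low-degree components of ideals generated by standard values -/

section Ideal

open Polynomial

variable {F : Type*} [Field F]

theorem trace_coeff_mul_comm {A V : Type*} [Ring A] [AddCommGroup V] (τ : A →+ V)
    (hτ : ∀ a b, τ (a * b) = τ (b * a)) (n : ℕ) (p r : A[X]) :
    τ ((p * r).coeff n) = τ ((r * p).coeff n) := by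
  rw [coeff_mul, coeff_mul, map_sum, map_sum, ← Finset.Nat.sum_antidiagonal_swap]
  exact Finset.sum_congr rfl fun _ _ => hτ _ _

/-- A trace of the n-th coefficient is itself a trace on the polynomial ring. -/
theorem trace_coeff_standard {A V : Type*} [Ring A] [AddCommGroup V] (τ : A →+ V)
    (hτ : ∀ a b, τ (a * b) = τ (b * a)) (n : ℕ) {q : ℕ} (hq : 1 ≤ q) (p : Fin (2 * q) → A[X]) :
    τ ((standard p).coeff n) = 0 :=
  trace_standard (A := A[X]) (V := V)
    { toFun := fun p => τ (p.coeff n), map_zero' := by simp, map_add' := by simp }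
    (trace_coeff_mul_comm τ hτ n) hq p

theorem coeff_one_mul {A : Type*} [Ring A] (p r : A[X]) :
    (p * r).coeff 1 = p.coeff 0 * r.coeff 1 + p.coeff 1 * r.coeff 0 := by
  rw [coeff_mul, Finset.Nat.antidiagonal_succ]
  simp

variable {J : Type*} [Fintype J] {q : ℕ} {h : J → Fin (2 * q) → NCPoly F} {f : NCPoly F}

open Classical in
/-- The component of degree `2 q` of an element of an ideal generated by values of `S_{2q}`. -/
theorem exists_coeff_grade_eq
    (hf : f ∈ TwoSidedIdeal.span (Set.range fun j => standard (h j))) :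
    ∃ t : J → F, (grade F f).coeff (2 * q) =
      ∑ j, t j • standard fun i => linForm F (linCoeff (h j i)) := by
  rw [TwoSidedIdeal.mem_span_iff_mem_addSubgroup_closure] at hf
  induction hf using AddSubgroup.closure_induction with
  | mem x hx =>
    obtain ⟨_, ⟨a, -, _, ⟨j, rfl⟩, rfl⟩, b, -, rfl⟩ := hx
    obtain ⟨p, hp, hp0⟩ := exists_grade_standard (h j)
    -- In the lowest degree only the constant terms of the outer factors survive.
    refine ⟨Pi.single j (FreeAlgebra.algebraMapInv a * FreeAlgebra.algebraMapInv b), ?_⟩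
    have e : grade F a * (p * X ^ (2 * q)) * grade F b =
        grade F a * p * grade F b * X ^ (2 * q) := by
      rw [mul_assoc, mul_assoc p, X_pow_mul]; simp only [mul_assoc]
    simp only [map_mul]
    rw [hp, e, coeff_mul_X_pow', if_pos le_rfl, Nat.sub_self, mul_coeff_zero, mul_coeff_zero, hp0,
      coeff_zero_grade, coeff_zero_grade, Finset.sum_eq_single j]
    · rw [Pi.single_eq_same, mul_smul, mul_assoc, ← Algebra.commutes, Algebra.smul_def,
        Algebra.smul_def]
    · intro j' _ hj'; simp [hj']
    · simp
  | zero => exact ⟨0, by simp⟩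
  | add x y _ _ hx hy =>
    obtain ⟨t, ht⟩ := hx
    obtain ⟨s, hs⟩ := hy
    exact ⟨t + s, by simp [ht, hs, add_smul, Finset.sum_add_distrib]⟩
  | neg x _ hx =>
    obtain ⟨t, ht⟩ := hx
    exact ⟨-t, by simp [ht]⟩

open Classical in
/-- The component of degree `2 q + 1`, up to commutators, of an element of an ideal generated by
values of `S_{2q}`. -/
theorem exists_trace_coeff_grade_eq (hq : 1 ≤ q)
    (hf : f ∈ TwoSidedIdeal.span (Set.range fun j => standard (h j))) :
    ∃ e : J → ℕ →₀ F, ∀ τ : NCPoly F →ₗ[F] NCPoly F, (∀ a b, τ (a * b) = τ (b * a)) →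
      τ ((grade F f).coeff (2 * q + 1)) =
        ∑ j, τ (linForm F (e j) * standard fun i => linForm F (linCoeff (h j i))) := by
  rw [TwoSidedIdeal.mem_span_iff_mem_addSubgroup_closure] at hf
  induction hf using AddSubgroup.closure_induction with
  | mem x hx =>
    obtain ⟨_, ⟨a, -, _, ⟨j, rfl⟩, rfl⟩, b, -, rfl⟩ := hx
    obtain ⟨p, hp, hp0⟩ := exists_grade_standard (h j)
    -- The extra degree comes from `a`, from `b` or from S(h). The last contribution has trace zero,
    -- and in the second the linear part of `b` is moved to the front under the trace.
    refine ⟨Pi.single j (FreeAlgebra.algebraMapInv b • linCoeff a +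
      FreeAlgebra.algebraMapInv a • linCoeff b), fun τ hτ => ?_⟩
    have e : grade F a * (p * X ^ (2 * q)) * grade F b =
        grade F a * p * grade F b * X ^ (2 * q) := by
      rw [mul_assoc, mul_assoc p, X_pow_mul]; simp only [mul_assoc]
    have hp1 : τ (p.coeff 1) = 0 := by
      have h1 : τ ((grade F (standard (h j))).coeff (2 * q + 1)) = 0 := by
        rw [map_standard]
        exact trace_coeff_standard τ.toAddMonoidHom hτ _ hq _
      rwa [hp, coeff_mul_X_pow', if_pos (by omega), Nat.add_sub_cancel_left] at h1
    simp only [map_mul]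
    rw [hp, e, coeff_mul_X_pow', if_pos (by omega), Nat.add_sub_cancel_left, coeff_one_mul,
      coeff_one_mul, mul_coeff_zero, hp0, coeff_zero_grade, coeff_zero_grade,
      Finset.sum_eq_single j]
    · rw [Pi.single_eq_same, coeff_one_grade, coeff_one_grade]
      simp only [Algebra.algebraMap_eq_smul_one, map_add, map_smul, add_mul, smul_mul_assoc,
        one_mul, mul_smul_comm, mul_one, hp1, smul_zero, zero_add]
      rw [hτ _ (linForm F (linCoeff b)), add_comm]
    · intro j' _ hj'; simp [hj']
    · simp
  | zero => exact ⟨0, fun τ _ => by simp⟩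
  | add x y _ _ hx hy =>
    obtain ⟨t, ht⟩ := hx
    obtain ⟨s, hs⟩ := hy
    exact ⟨t + s, fun τ hτ => by
      simp [ht τ hτ, hs τ hτ, add_mul, Finset.sum_add_distrib]⟩
  | neg x _ hx =>
    obtain ⟨t, ht⟩ := hx
    exact ⟨-t, fun τ hτ => by simp [ht τ hτ]⟩

end Ideal

/-! ### Cyclic derivatives of products e·S(ℓ) -/

section Extraction

variable {F : Type*} [Field F]

theorem restrictVars_linForm (p : ℕ → Prop) [DecidablePred p] (c : ℕ →₀ F) :
    restrictVars F p (linForm F c) = linForm F (c.filter p) := by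
  induction c using Finsupp.induction_linear with
  | zero => simp [Finsupp.filter_zero]
  | add c e hc he => rw [map_add, map_add, hc, he, Finsupp.filter_add, map_add]
  | single v a =>
    by_cases hv : p v
    · simp [hv, restrictVars_var]
    · simp [hv, restrictVars_var]

theorem restrictVars_linForm_or (p : ℕ → Prop) [DecidablePred p] {z : ℕ} (hz : ¬ p z)
    (c : ℕ →₀ F) :
    restrictVars F (fun v => p v ∨ v = z) (linForm F c) =
      linForm F (c.filter p) + c z • var F z := by
  have : c.filter (fun v => p v ∨ v = z) = c.filter p + Finsupp.single z (c z) := by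
    ext v
    by_cases hv : v = z
    · subst hv; simp [hz]
    · by_cases hp : p v <;> simp [hp, hv]
  rw [restrictVars_linForm, this, map_add]
  simp

/-- The cyclic derivative of the product of a linear form with a standard polynomial of linear
forms. -/
theorem cyclicDeriv_linForm_mul_standard (p : ℕ → Prop) [DecidablePred p] {z : ℕ} (hz : ¬ p z)
    {q : ℕ} (e : ℕ →₀ F) (c : Fin (2 * q) → ℕ →₀ F) :
    cyclicDeriv F z (restrictVars F (fun v => p v ∨ v = z)
        (linForm F e * standard fun i => linForm F (c i))) =
      e z • standard (fun i => linForm F ((c i).filter p)) -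
        ∑ i, c i z • standard (Function.update (fun i => linForm F ((c i).filter p)) i
          (linForm F (e.filter p))) := by
  have hfix : ∀ c : ℕ →₀ F, restrictVars F (· ≠ z) (linForm F (c.filter p)) =
      linForm F (c.filter p) := by
    intro c
    rw [restrictVars_linForm]
    congr 1
    ext v
    by_cases hv : v = z
    · subst hv; simp [hz]
    · simp [hv]
  have hS : ∀ b : Fin (2 * q) → NCPoly F, (∀ i, restrictVars F (· ≠ z) (b i) = b i) →
      restrictVars F (· ≠ z) (standard b) = standard b := by
    intro b hb
    rw [map_standard]; simp only [hb]
  rw [map_mul, map_standard]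
  simp only [restrictVars_linForm_or p hz]
  rw [add_mul, map_add, smul_mul_assoc, map_smul, cyclicDeriv_var_mul, map_standard]
  simp only [map_add, map_smul, hfix, restrictVars_var, ne_eq, not_true_eq_false, if_false,
    smul_zero, add_zero]
  rw [standard_add_smul, mul_add, map_add, Finset.mul_sum, map_sum]
  -- No z occurs in this product.
  have h0 : cyclicDeriv F z (linForm F (e.filter p) *
      standard fun i => linForm F ((c i).filter p)) = 0 := by
    rw [← hfix e, ← hS _ fun i => hfix (c i), ← map_mul, cyclicDeriv_restrictVars]
  rw [h0, zero_add, add_comm, sub_eq_add_neg, ← Finset.sum_neg_distrib]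
  congr 1
  refine Finset.sum_congr rfl fun i _ => ?_
  -- The trace exchanges z, in slot i of S, with the linear form in front.
  have ht := trace_mul_standard (cyclicDeriv F z).toAddMonoidHom (cyclicDeriv_mul_comm z)
    (linForm F (e.filter p))
    (Function.update (fun i => linForm F ((c i).filter p)) i (var F z)) i
  simp only [LinearMap.toAddMonoidHom_coe, Function.update_self, Function.update_idem] at ht
  rw [mul_smul_comm, map_smul, ht, cyclicDeriv_var_mul, hS, smul_neg]
  intro i'
  by_cases hi : i' = i
  · subst hi; simp [hfix]
  · simp [hi, hfix]

end Extraction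

/-! ### Transfer of generators from ∑ z_i P_i to the P_i -/

section Generation

variable {F : Type*} [Field F]

theorem isSubstInstance_standardPoly_iff {m : ℕ} {g : NCPoly F} :
    IsSubstInstance {standardPoly F m} g ↔ ∃ h : Fin m → NCPoly F, g = standard h := by
  constructor
  · rintro ⟨_, rfl, s, rfl⟩
    exact ⟨fun i => s i, by simp [standardPoly, map_standard, var]⟩
  · rintro ⟨h, rfl⟩
    refine ⟨_, rfl, fun v => if hv : v < m then h ⟨v, hv⟩ else 0, ?_⟩
    simp [standardPoly, map_standard, var]

theorem generatedBy_standardPoly_iff {m k : ℕ} {I : Type*} {f : I → NCPoly F} :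
    GeneratedBy {standardPoly F m} f k ↔ ∃ h : Fin k → Fin m → NCPoly F,
      ∀ i, f i ∈ TwoSidedIdeal.span (Set.range fun j => standard (h j)) := by
  constructor
  · rintro ⟨g, hg, hf⟩
    simp only [isSubstInstance_standardPoly_iff] at hg
    choose h hh using hg
    exact ⟨h, by rwa [← (funext hh : g = fun j => standard (h j))]⟩
  · rintro ⟨h, hf⟩
    exact ⟨_, fun j => isSubstInstance_standardPoly_iff.2 ⟨h j, rfl⟩, hf⟩

theorem generatedBy_of_fintype {m : ℕ} {I J : Type*} [Fintype J] {f : I → NCPoly F}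
    (h : J → Fin m → NCPoly F)
    (hf : ∀ i, f i ∈ TwoSidedIdeal.span (Set.range fun j => standard (h j))) :
    GeneratedBy {standardPoly F m} f (Fintype.card J) := by
  refine generatedBy_standardPoly_iff.2 ⟨h ∘ (Fintype.equivFin J).symm, fun i => ?_⟩
  convert hf i using 2
  exact (Fintype.equivFin J).symm.surjective.range_comp (fun j => standard (h j))

theorem GeneratedBy.mono {m k l : ℕ} {I : Type*} {f : I → NCPoly F}
    (h : GeneratedBy {standardPoly F m} f k) (hkl : k ≤ l) :
    GeneratedBy {standardPoly F m} f l := by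
  obtain ⟨g, hg⟩ := generatedBy_standardPoly_iff.1 h
  obtain ⟨r, rfl⟩ := Nat.exists_eq_add_of_le hkl
  refine generatedBy_standardPoly_iff.2 ⟨Fin.append g fun _ => 0, fun i => ?_⟩
  refine TwoSidedIdeal.span_mono ?_ (hg i)
  rintro _ ⟨j, rfl⟩
  exact ⟨Fin.castAdd r j, by simp⟩

theorem smul_mem_twoSidedIdeal {I : TwoSidedIdeal (NCPoly F)} {x : NCPoly F} (hx : x ∈ I) (c : F) :
    c • x ∈ I := by
  rw [Algebra.smul_def]
  exact I.mul_mem_left _ _ hx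

theorem var_eq_linForm (v : ℕ) : var F v = linForm F (Finsupp.single v 1) := by simp

theorem IsSPolynomial.grade_eq {d n : ℕ} {P : NCPoly F} (hP : IsSPolynomial d n P) :
    grade F P = Polynomial.C P * Polynomial.X ^ (2 * d) := by
  obtain ⟨c, -, rfl⟩ := hP
  rw [map_sum, map_sum, Finset.sum_mul]
  refine Finset.sum_congr rfl fun j _ => ?_
  rw [map_smul, ← Polynomial.smul_C, smul_mul_assoc]
  simp only [var_eq_linForm]
  rw [grade_standard_linForm]

theorem IsSPolynomial.restrictVars_eq {d n : ℕ} {P : NCPoly F} (hP : IsSPolynomial d n P)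
    {p : ℕ → Prop} [DecidablePred p] (hp : ∀ v < n, p v) : restrictVars F p P = P := by
  obtain ⟨c, -, rfl⟩ := hP
  rw [map_sum]
  refine Finset.sum_congr rfl fun j _ => ?_
  rw [map_smul, map_standard]
  simp [restrictVars_var, hp]

/-- From generators of `∑ z_i P_i` one obtains generators of the whole family `P`. -/
theorem generatedBy_of_combine {d : ℕ} (hd : 1 ≤ d) {n k : ℕ} {P : Fin n → NCPoly F}
    {z : Fin n → ℕ} (hP : ∀ i, IsSPolynomial d n (P i)) (hz : IsNewVars n z)
    (h : GeneratedBy {standardPoly F (2 * d)} (fun _ : Unit => combine z P) k) :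
    GeneratedBy {standardPoly F (2 * d)} P ((2 * d + 1) * k) := by
  obtain ⟨h, hf⟩ := generatedBy_standardPoly_iff.1 h
  obtain ⟨e, he⟩ := exists_trace_coeff_grade_eq hd (hf ())
  let L : Fin k → Fin (2 * d) → NCPoly F :=
    fun j i => linForm F ((linCoeff (h j i)).filter (· < n))
  -- Index `none` keeps the truncated forms, `some i` puts the truncated e in slot i. None of these
  -- depends on which P is to be recovered.
  let g : Option (Fin (2 * d)) × Fin k → Fin (2 * d) → NCPoly F := fun x =>
    x.1.elim (L x.2) fun i => Function.update (L x.2) i (linForm F ((e x.2).filter (· < n)))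
  have hcard : Fintype.card (Option (Fin (2 * d)) × Fin k) = (2 * d + 1) * k := by simp
  rw [← hcard]
  refine generatedBy_of_fintype g fun i => ?_
  have hgrade : (grade F (combine z P)).coeff (2 * d + 1) = combine z P := by
    simp only [combine, map_sum, map_mul, (hP _).grade_eq, grade_var, Polynomial.finsetSum_coeff]
    refine Finset.sum_congr rfl fun i _ => ?_
    rw [mul_assoc, ← mul_assoc Polynomial.X, Polynomial.X_mul_C, mul_assoc, ← pow_succ',
      ← mul_assoc, ← map_mul, Polynomial.coeff_C_mul_X_pow, if_pos rfl]
  have hzi : ¬ z i < n := not_lt.2 (hz.2 i)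
  -- The trace used: set the other new variables to 0, then take the cyclic derivative in z_i.
  have key := he ((cyclicDeriv F (z i)).comp
    (restrictVars F (fun v => v < n ∨ v = z i)).toLinearMap) (fun a b => by
      simp [map_mul, cyclicDeriv_mul_comm])
  have hleft : cyclicDeriv F (z i) (restrictVars F (fun v => v < n ∨ v = z i) (combine z P)) =
      P i := by
    have hsum : restrictVars F (fun v => v < n ∨ v = z i) (combine z P) = var F (z i) * P i := by
      rw [combine, map_sum, Finset.sum_eq_single i]
      · rw [map_mul, restrictVars_var, if_pos (Or.inr rfl),
          (hP i).restrictVars_eq fun v hv => Or.inl hv]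
      · intro j _ hj
        rw [map_mul, restrictVars_var, if_neg, zero_mul]
        rintro (h | h)
        · exact absurd h (not_lt.2 (hz.2 j))
        · exact hj (hz.1 h)
      · simp
    rw [hsum, cyclicDeriv_var_mul, (hP i).restrictVars_eq]
    rintro v hv rfl
    exact hzi hv
  simp only [LinearMap.comp_apply, AlgHom.toLinearMap_apply, hgrade, hleft] at key
  rw [key]
  refine sum_mem fun j _ => ?_
  rw [cyclicDeriv_linForm_mul_standard (· < n) hzi]
  have hmem : ∀ x, standard (g x) ∈ TwoSidedIdeal.span (Set.range fun x => standard (g x)) :=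
    fun x => TwoSidedIdeal.subset_span ⟨x, rfl⟩
  exact sub_mem (smul_mem_twoSidedIdeal (hmem (none, j)) _)
    (sum_mem fun i' _ => smul_mem_twoSidedIdeal (hmem (some i', j)) _)

theorem Q_le_iff_generatedBy {m k : ℕ} {I : Type*} {f : I → NCPoly F} :
    Q {standardPoly F m} f ≤ k ↔ GeneratedBy {standardPoly F m} f k := by
  constructor
  · intro h
    have hne : {q : ℕ∞ | ∃ k : ℕ, q = k ∧ GeneratedBy {standardPoly F m} f k}.Nonempty := by
      by_contra hne
      rw [Set.not_nonempty_iff_eq_empty] at hne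
      rw [Q, hne, sInf_empty] at h
      exact absurd h (by simp)
    obtain ⟨l, hl, hg⟩ := csInf_mem hne
    change Q _ _ = _ at hl
    rw [hl] at h
    exact hg.mono (by exact_mod_cast h)
  · intro h
    exact sInf_le ⟨k, rfl, h⟩

theorem Q_le_mul_Q_combine {d : ℕ} (hd : 1 ≤ d) {n : ℕ} {P : Fin n → NCPoly F}
    {z : Fin n → ℕ} (hP : ∀ i, IsSPolynomial d n (P i)) (hz : IsNewVars n z) :
    Q {standardPoly F (2 * d)} P ≤
      ((2 * d + 1 : ℕ) : ℕ∞) * Q₁ {standardPoly F (2 * d)} (combine z P) := by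
  rcases eq_or_ne (Q₁ {standardPoly F (2 * d)} (combine z P)) ⊤ with h | h
  · rw [h, ENat.mul_top (by simp)]
    exact le_top
  · obtain ⟨k, hk⟩ := ENat.ne_top_iff_exists.1 h
    rw [← hk]
    have := generatedBy_of_combine hd hP hz (Q_le_iff_generatedBy.1 hk.ge)
    exact_mod_cast Q_le_iff_generatedBy.2 this

end Generation


/-! ### Counting 0/1 values of polynomial maps -/

section Counting

/-- The exponent vectors of the monomials of degree at most `M`. -/
def exponents (Ω : Type*) [Fintype Ω] [DecidableEq Ω] (M : ℕ) : Finset (Ω → ℕ) :=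
  (Fintype.piFinset fun _ => Finset.range (M + 1)).filter fun e => ∑ i, e i ≤ M

theorem mem_exponents {Ω : Type*} [Fintype Ω] [DecidableEq Ω] {M : ℕ} {e : Ω → ℕ} :
    e ∈ exponents Ω M ↔ ∑ i, e i ≤ M := by
  simp only [exponents, Finset.mem_filter, Fintype.mem_piFinset, Finset.mem_range,
    and_iff_right_iff_imp]
  intro h i
  have := Finset.single_le_sum (f := e) (fun i _ => Nat.zero_le _) (Finset.mem_univ i)
  omega

theorem card_exponents_mul_pow_le (Ω : Type*) [Fintype Ω] [DecidableEq Ω] (M : ℕ) {x : ℝ}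
    (hx0 : 0 < x) (hx1 : x < 1) :
    ((exponents Ω M).card : ℝ) * x ^ M ≤ (1 - x)⁻¹ ^ Fintype.card Ω := by
  calc ((exponents Ω M).card : ℝ) * x ^ M = ∑ e ∈ exponents Ω M, x ^ M := by simp
    _ ≤ ∑ e ∈ exponents Ω M, ∏ i, x ^ e i := by
        refine Finset.sum_le_sum fun e he => ?_
        rw [Finset.prod_pow_eq_pow_sum]
        exact pow_le_pow_of_le_one hx0.le hx1.le (mem_exponents.1 he)
    _ ≤ ∑ e ∈ Fintype.piFinset fun _ : Ω => Finset.range (M + 1), ∏ i, x ^ e i :=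
        Finset.sum_le_sum_of_subset_of_nonneg (Finset.filter_subset _ _) fun e _ _ => by positivity
    _ = ∏ _i : Ω, ∑ a ∈ Finset.range (M + 1), x ^ a :=
        (Finset.prod_univ_sum (fun _ : Ω => Finset.range (M + 1)) fun _ a => x ^ a).symm
    _ ≤ (1 - x)⁻¹ ^ Fintype.card Ω := by
        rw [Finset.prod_const, Finset.card_univ]
        refine pow_le_pow_left₀ (Finset.sum_nonneg fun _ _ => by positivity) ?_ _
        rw [← tsum_geometric_of_lt_one hx0.le hx1]
        exact (summable_geometric_of_lt_one hx0.le hx1).sum_le_tsum _ fun _ _ => by positivity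

open MvPolynomial in
/-- If all `0/1` vectors are values of a polynomial map of degree `D`, then the number of its
coordinates is bounded by the number of monomials. -/
theorem two_pow_le_card_exponents {F Ω T : Type*} [Field F] [Fintype Ω] [DecidableEq Ω]
    [Fintype T] [DecidableEq T] {D : ℕ} (φ : T → MvPolynomial Ω F)
    (hφ : ∀ t, (φ t).totalDegree ≤ D) (v : Finset T → Ω → F)
    (hv : ∀ s t, eval (v s) (φ t) = if t ∈ s then 1 else 0) :
    2 ^ Fintype.card T ≤ (exponents Ω (Fintype.card T * D)).card := by
  set E := exponents Ω (Fintype.card T * D)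
  -- Monomials are viewed as functions on the set of subsets of T through the points `v s`; they
  -- turn out to span all such functions.
  let b : E → Finset T → F := fun e s => ∏ i, v s i ^ e.1 i
  have htop : Submodule.span F (Set.range b) = ⊤ := by
    rw [eq_top_iff, ← (Pi.basisFun F (Finset T)).span_eq, Submodule.span_le]
    rintro _ ⟨s, rfl⟩
    -- Evaluated at the points `v s'`, this product is the indicator of s' = s.
    let p : MvPolynomial Ω F := ∏ t, if t ∈ s then φ t else 1 - φ t
    have hdeg : p.totalDegree ≤ Fintype.card T * D := by
      refine (totalDegree_finsetProd _ _).trans ?_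
      rw [← smul_eq_mul, ← Finset.card_univ]
      refine Finset.sum_le_card_nsmul _ _ _ fun t _ => ?_
      split_ifs
      · exact hφ t
      · refine (totalDegree_sub _ _).trans ?_
        simp [hφ t]
    have hp : (Pi.basisFun F (Finset T) s) = fun s' => eval (v s') p := by
      ext s'
      rw [Pi.basisFun_apply, map_prod, Pi.single_apply]
      split_ifs with h
      · subst h
        refine (Finset.prod_eq_one fun t _ => ?_).symm
        split_ifs with ht <;> simp [hv, ht]
      · obtain ⟨t, ht⟩ : ∃ t, ¬ (t ∈ s' ↔ t ∈ s) := by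
          by_contra hne
          push Not at hne
          exact h (Finset.ext hne)
        refine (Finset.prod_eq_zero (Finset.mem_univ t) ?_).symm
        by_cases h1 : t ∈ s <;> by_cases h2 : t ∈ s' <;> simp_all
    rw [hp]
    have hsum : (fun s' => eval (v s') p) =
        ∑ e ∈ p.support, p.coeff e • fun s' => ∏ i, v s' i ^ e i := by
      ext s'
      simp [eval_eq']
    rw [hsum]
    refine Submodule.sum_mem _ fun e he => Submodule.smul_mem _ _ (Submodule.subset_span ?_)
    refine ⟨⟨e, mem_exponents.2 ?_⟩, rfl⟩
    refine le_trans ?_ ((le_totalDegree he).trans hdeg)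
    rw [Finsupp.sum_fintype _ _ (by simp)]
  have hcard := finrank_range_le_card (R := F) b
  rw [Set.finrank, htop, finrank_top, Module.finrank_fintype_fun_eq_card, Fintype.card_finset,
    Fintype.card_coe] at hcard
  exact hcard

open MvPolynomial in
theorem pow_card_le_pow_card {F Ω T : Type*} [Field F] [Fintype Ω] [DecidableEq Ω]
    [Fintype T] [DecidableEq T] {D : ℕ} (hD : 1 ≤ D) (φ : T → MvPolynomial Ω F)
    (hφ : ∀ t, (φ t).totalDegree ≤ D) (v : Finset T → Ω → F)
    (hv : ∀ s t, eval (v s) (φ t) = if t ∈ s then 1 else 0) :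
    (3 / 2 : ℝ) ^ Fintype.card T ≤ (4 * D) ^ Fintype.card Ω := by
  have hD' : (1 : ℝ) ≤ D := by exact_mod_cast hD
  have h1 : (2 : ℝ) ^ Fintype.card T ≤ (exponents Ω (Fintype.card T * D)).card := by
    exact_mod_cast two_pow_le_card_exponents φ hφ v hv
  have hx : (4 * (D : ℝ))⁻¹ ≤ 4⁻¹ := by gcongr; linarith
  have hx0 : 0 < (4 * (D : ℝ))⁻¹ := by positivity
  -- With x = 1 - 1/(4D) the right side is a power of 4D, while Bernoulli gives x^D ≥ 3/4, so 2·x^D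
  -- is still at least 3/2.
  have h2 := card_exponents_mul_pow_le Ω (Fintype.card T * D) (x := 1 - (4 * (D : ℝ))⁻¹)
    (by linarith) (by linarith)
  rw [sub_sub_cancel, inv_inv] at h2
  have h3 : (3 / 4 : ℝ) ≤ (1 - (4 * (D : ℝ))⁻¹) ^ D := by
    have := one_add_mul_le_pow (a := -(4 * (D : ℝ))⁻¹) (by linarith) D
    have h4 : (D : ℝ) * -(4 * (D : ℝ))⁻¹ = -(1 / 4) := by field_simp
    rw [h4, ← sub_eq_add_neg, ← sub_eq_add_neg] at this
    linarith
  calc (3 / 2 : ℝ) ^ Fintype.card T = 2 ^ Fintype.card T * (3 / 4) ^ Fintype.card T := by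
        rw [← mul_pow]; norm_num
    _ ≤ (exponents Ω (Fintype.card T * D)).card *
        ((1 - (4 * (D : ℝ))⁻¹) ^ D) ^ Fintype.card T := by gcongr
    _ ≤ _ := by rwa [← pow_mul, mul_comm D]

end Counting

/-! ### Coefficients of standard polynomials of linear forms -/

section Coefficients

variable {F : Type*} [Field F]

/-- The coefficient of a monomial. -/
noncomputable def coeffWord (F : Type*) [Field F] (w : List ℕ) : NCPoly F →ₗ[F] F :=
  wordLift fun u => if u = w then 1 else 0

theorem coeffWord_cons_var_mul (v u : ℕ) (w : List ℕ) (f : NCPoly F) :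
    coeffWord F (v :: w) (var F u * f) = if u = v then coeffWord F w f else 0 := by
  have : (coeffWord F (v :: w)).comp (LinearMap.mulLeft F (var F u)) =
      if u = v then coeffWord F w else 0 := by
    refine linearMap_ext_word fun x => ?_
    rw [LinearMap.comp_apply, LinearMap.mulLeft_apply, ← word_cons, coeffWord, wordLift_word]
    by_cases h : u = v
    · simp [h, coeffWord, wordLift_word]
    · simp [h]
  have h2 := LinearMap.congr_fun this f
  rw [LinearMap.comp_apply, LinearMap.mulLeft_apply] at h2
  rw [h2]
  split_ifs <;> rfl

theorem coeffWord_cons_linForm_mul (v : ℕ) (w : List ℕ) (c : ℕ →₀ F) (f : NCPoly F) :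
    coeffWord F (v :: w) (linForm F c * f) = c v * coeffWord F w f := by
  induction c using Finsupp.induction_linear with
  | zero => simp
  | add c e hc he => rw [map_add, add_mul, map_add, hc, he, Finsupp.add_apply, add_mul]
  | single u a =>
    rw [Finsupp.linearCombination_single, smul_mul_assoc, map_smul, coeffWord_cons_var_mul,
      Finsupp.single_apply]
    split_ifs <;> simp

theorem coeffWord_prod_linForm {m : ℕ} (c : Fin m → ℕ →₀ F) (J : Fin m → ℕ) :
    coeffWord F (List.ofFn J) (List.ofFn fun l => linForm F (c l)).prod = ∏ l, c l (J l) := by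
  induction m with
  | zero => simp [← word_nil F, coeffWord, wordLift_word]
  | succ m ih =>
    rw [List.ofFn_succ, List.ofFn_succ, List.prod_cons, coeffWord_cons_linForm_mul, ih,
      Fin.prod_univ_succ]

/-- The coefficient is a determinant, hence a polynomial of degree m in the coefficients of the
forms; this supplies the polynomial map for the counting. -/
theorem coeffWord_standard_linForm {m : ℕ} (c : Fin m → ℕ →₀ F) (J : Fin m → ℕ) :
    coeffWord F (List.ofFn J) (standard fun l => linForm F (c l)) =
      ∑ σ : Equiv.Perm (Fin m), ((Equiv.Perm.sign σ : ℤˣ) : ℤ) • ∏ l, c (σ l) (J l) := by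
  rw [standard, map_sum]
  refine Finset.sum_congr rfl fun σ _ => ?_
  rw [map_zsmul, coeffWord_prod_linForm fun l => c (σ l)]

theorem coeffWord_standard_var {m : ℕ} {J J' : Fin m → ℕ} (hJ : StrictMono J)
    (hJ' : StrictMono J') :
    coeffWord F (List.ofFn J) (standard fun l => var F (J' l)) = if J = J' then 1 else 0 := by
  simp only [var_eq_linForm]
  rw [coeffWord_standard_linForm]
  -- A permutation matching two increasing sequences is increasing, hence the identity.
  have hone : ∀ σ : Equiv.Perm (Fin m), (∀ l, J' (σ l) = J l) → σ = 1 ∧ J = J' := by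
    intro σ hσ
    have hσm : StrictMono σ := fun a b hab => hJ'.lt_iff_lt.1 (by rw [hσ, hσ]; exact hJ hab)
    have h1 : σ = 1 := by
      have := Subsingleton.elim (StrictMono.orderIsoOfSurjective σ hσm σ.surjective)
        (OrderIso.refl _)
      ext i
      have := DFunLike.congr_fun this i
      simpa using congrArg Fin.val this
    subst h1
    exact ⟨rfl, funext fun l => (hσ l).symm⟩
  split_ifs with h
  · subst h
    rw [Finset.sum_eq_single 1]
    · simp
    · intro σ _ hσ
      obtain ⟨l, hl⟩ : ∃ l, J (σ l) ≠ J l := by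
        by_contra hne
        push Not at hne
        exact hσ (hone σ hne).1
      rw [Finset.prod_eq_zero (Finset.mem_univ l) (by simp [hl]), smul_zero]
    · simp
  · refine Finset.sum_eq_zero fun σ _ => ?_
    obtain ⟨l, hl⟩ : ∃ l, J' (σ l) ≠ J l := by
      by_contra hne
      push Not at hne
      exact h (hone σ hne).2
    rw [Finset.prod_eq_zero (Finset.mem_univ l) (by simp [hl]), smul_zero]

end Coefficients


/-! ### Hard families of s-polynomials -/

section LowerBound

variable {F : Type*} [Field F]

open Classical in
theorem card_strictMono (m n : ℕ) :
    Fintype.card {J : Fin m → Fin n // StrictMono J} = n.choose m := by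
  let e : {J : Fin m → Fin n // StrictMono J} ≃ (Fin m ↪o Fin n) :=
    { toFun := fun J => OrderEmbedding.ofStrictMono J.1 J.2
      invFun := fun J => ⟨J, J.strictMono⟩
      left_inv := fun J => rfl
      right_inv := fun J => rfl }
  rw [← Nat.card_eq_fintype_card,
    Nat.card_congr (e.trans (Set.powersetCard.ofFinEmbEquiv (n := m) (I := Fin n)))]
  rw [Set.powersetCard.card, Nat.card_fin]

open Classical in
/-- The s-polynomials with prescribed sets of monomials. -/
noncomputable def sFamily (F : Type*) [Field F] (d n : ℕ)
    (s : Finset (Fin n × {J : Fin (2 * d) → Fin n // StrictMono J})) (i : Fin n) : NCPoly F :=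
  ∑ J : Fin (2 * d) → Fin n with StrictMono J,
    (if ∃ hJ : StrictMono J, (i, ⟨J, hJ⟩) ∈ s then (1 : F) else 0) •
      standard fun k => var F (J k : ℕ)

theorem isSPolynomial_sFamily {d n : ℕ}
    (s : Finset (Fin n × {J : Fin (2 * d) → Fin n // StrictMono J})) (i : Fin n) :
    IsSPolynomial d n (sFamily F d n s i) := by
  classical
  refine ⟨fun J => if ∃ hJ : StrictMono J, (i, ⟨J, hJ⟩) ∈ s then 1 else 0, fun J => ?_, ?_⟩
  · dsimp only
    split_ifs
    · exact Or.inr rfl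
    · exact Or.inl rfl
  · unfold sFamily
    rfl

open Classical in
theorem coeffWord_sFamily {d n : ℕ}
    (s : Finset (Fin n × {J : Fin (2 * d) → Fin n // StrictMono J})) (i : Fin n)
    (J : {J : Fin (2 * d) → Fin n // StrictMono J}) :
    coeffWord F (List.ofFn fun l => (J.1 l : ℕ)) (sFamily F d n s i) =
      if (i, J) ∈ s then 1 else 0 := by
  rw [sFamily, map_sum, Finset.sum_eq_single J.1]
  · rw [map_smul, coeffWord_standard_var (J := fun l => (J.1 l : ℕ)) (J' := fun l => (J.1 l : ℕ))
      J.2 J.2, if_pos rfl]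
    simp [J.2]
  · intro J' hJ' hne
    have hJ' : StrictMono J' := by simpa using hJ'
    have hne' : ¬ (fun l => (J.1 l : ℕ)) = fun l => (J' l : ℕ) := fun h =>
      hne (funext fun l => Fin.ext (congrFun h l).symm)
    rw [map_smul, coeffWord_standard_var (J := fun l => (J.1 l : ℕ)) (J' := fun l => (J' l : ℕ))
      J.2 hJ', if_neg hne', smul_zero]
  · intro h
    exact absurd J.2 (by simpa using h)

open MvPolynomial in
theorem pow_choose_le_of_generatedBy {d n k : ℕ}
    (h : ∀ s, GeneratedBy {standardPoly F (2 * d)} (sFamily F d n s) k) :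
    (3 / 2 : ℝ) ^ (n * n.choose (2 * d)) ≤
      (4 * ((2 * d + 1 : ℕ) : ℝ)) ^ (n * ((2 * d + 1) * k)) := by
  classical
  simp only [generatedBy_standardPoly_iff] at h
  choose h hmem using h
  have ht : ∀ s i, ∃ t : Fin k → F, sFamily F d n s i =
      ∑ j, t j • standard fun l => linForm F (linCoeff (h s j l)) := by
    intro s i
    obtain ⟨t, ht⟩ := exists_coeff_grade_eq (hmem s i)
    refine ⟨t, ?_⟩
    rw [← ht, (isSPolynomial_sFamily s i).grade_eq, Polynomial.coeff_C_mul_X_pow, if_pos rfl]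
  choose t ht using ht
  -- The parameters are the scalars t_{ij} and the coefficients of the linear forms at the first n
  -- variables; no other variable occurs in the monomials compared.
  let Ω := (Fin n × Fin k) ⊕ (Fin k × Fin (2 * d) × Fin n)
  let φ : Fin n × {J : Fin (2 * d) → Fin n // StrictMono J} → MvPolynomial Ω F := fun x =>
    ∑ j : Fin k, X (Sum.inl (x.1, j)) * ∑ σ : Equiv.Perm (Fin (2 * d)),
      ((Equiv.Perm.sign σ : ℤˣ) : ℤ) • ∏ l, X (Sum.inr (j, σ l, x.2.1 l))
  let v : Finset (Fin n × {J : Fin (2 * d) → Fin n // StrictMono J}) → Ω → F := fun s =>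
    Sum.elim (fun x => t s x.1 x.2) fun x => linCoeff (h s x.1 x.2.1) x.2.2
  have hdeg : ∀ x, (φ x).totalDegree ≤ 2 * d + 1 := by
    intro x
    refine totalDegree_finsetSum_le fun j _ => (totalDegree_mul _ _).trans ?_
    rw [totalDegree_X, add_comm]
    gcongr
    refine totalDegree_finsetSum_le fun σ _ => ?_
    rw [zsmul_eq_mul]
    refine (totalDegree_mul _ _).trans ?_
    have h1 : (((Equiv.Perm.sign σ : ℤˣ) : ℤ) : MvPolynomial Ω F).totalDegree = 0 := by
      rw [← map_intCast (C : F →+* MvPolynomial Ω F), totalDegree_C]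
    rw [h1, zero_add]
    refine (totalDegree_finsetProd _ _).trans ?_
    simp [totalDegree_X]
  have heval : ∀ s x, eval (v s) (φ x) = if x ∈ s then 1 else 0 := by
    rintro s ⟨i, J⟩
    rw [← coeffWord_sFamily (F := F), ht s i, map_sum, map_sum]
    refine Finset.sum_congr rfl fun j _ => ?_
    rw [map_mul, eval_X, map_smul, coeffWord_standard_linForm, map_sum, smul_eq_mul]
    simp only [map_zsmul, map_prod, eval_X]
    rfl
  have := pow_card_le_pow_card (by omega) φ hdeg v heval
  have hΩ : Fintype.card Ω = n * ((2 * d + 1) * k) := by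
    simp [Ω]; ring
  rwa [Fintype.card_prod, card_strictMono, Fintype.card_fin, hΩ] at this

/-- There are families of s-polynomials that need many generators. -/
theorem exists_sFamily_hard (d : ℕ) : ∃ B : ℕ, 0 < B ∧ ∀ (F : Type*) [Field F] (n : ℕ), 0 < n →
    ∃ s, ∀ k, GeneratedBy {standardPoly F (2 * d)} (sFamily F d n s) k →
      n.choose (2 * d) ≤ B * k := by
  -- B converts the base (4(2d+1))^(2d+1) of the counting bound into a power of 3/2.
  obtain ⟨B, hB⟩ := pow_unbounded_of_one_lt ((4 * ((2 * d + 1 : ℕ) : ℝ)) ^ (2 * d + 1))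
    (by norm_num : (1 : ℝ) < 3 / 2)
  refine ⟨B + 1, Nat.succ_pos _, fun F _ n hn => ?_⟩
  rcases Nat.eq_zero_or_pos (n.choose (2 * d)) with h0 | hpos
  · exact ⟨∅, fun k _ => by simp [h0]⟩
  -- The largest k₀ with (B+1)k₀ < C(n,2d): too few generators for some family, while k₀+1 already
  -- satisfies the claimed inequality.
  obtain ⟨k₀, hk₀⟩ : ∃ k₀, k₀ = (n.choose (2 * d) - 1) / (B + 1) := ⟨_, rfl⟩
  have hlow : (B + 1) * k₀ ≤ n.choose (2 * d) - 1 := by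
    rw [hk₀]; exact Nat.mul_div_le _ _
  have hup : n.choose (2 * d) - 1 < (B + 1) * (k₀ + 1) := by
    rw [hk₀]; exact Nat.lt_mul_div_succ _ (Nat.succ_pos _)
  have hex : ∃ s, ¬ GeneratedBy {standardPoly F (2 * d)} (sFamily F d n s) k₀ := by
    by_contra hall
    push Not at hall
    have h1 := pow_choose_le_of_generatedBy hall
    -- Both exponents carry the factor n, which is removed by taking n-th roots.
    rw [mul_comm n, mul_comm n, pow_mul, pow_mul, pow_le_pow_iff_left₀ (by positivity)
      (by positivity) hn.ne', pow_mul] at h1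
    have h2 : (3 / 2 : ℝ) ^ n.choose (2 * d) ≤ (3 / 2) ^ (B * k₀) := by
      refine h1.trans ?_
      rw [pow_mul]
      gcongr
    rw [pow_le_pow_iff_right₀ (by norm_num)] at h2
    have : B * k₀ ≤ (B + 1) * k₀ := by gcongr; omega
    omega
  obtain ⟨s, hs⟩ := hex
  refine ⟨s, fun k hk => ?_⟩
  have hlt : k₀ + 1 ≤ k := by
    by_contra hle
    exact hs (hk.mono (by omega))
  have : (B + 1) * (k₀ + 1) ≤ (B + 1) * k := by gcongr
  omega

end LowerBound


/-! ### Nilpotency from vanishing traces of powers -/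

section TraceNilpotent

open Polynomial Matrix

theorem derivative_det {R n : Type*} [CommRing R] [Fintype n] [DecidableEq n]
    (M : Matrix n n R[X]) :
    derivative M.det = ∑ i, (M.updateRow i fun j => derivative (M i j)).det := by
  have hdet : ∀ N : Matrix n n R[X],
      N.det = ∑ σ : Equiv.Perm n, ((Equiv.Perm.sign σ : ℤˣ) : ℤ) • ∏ i, N i (σ i) := by
    intro N
    rw [← det_transpose, det_apply]
    simp [Units.smul_def]
  simp only [hdet, map_sum]
  rw [Finset.sum_comm]
  refine Finset.sum_congr rfl fun σ _ => ?_
  rw [← Finset.smul_sum, map_zsmul, derivative_prod_finset]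
  congr 1
  refine Finset.sum_congr rfl fun i _ => ?_
  rw [← Finset.mul_prod_erase _ _ (Finset.mem_univ i), mul_comm, updateRow_self]
  congr 1
  refine Finset.prod_congr rfl fun j hj => ?_
  rw [updateRow_ne (Finset.ne_of_mem_erase hj)]

/-- Differentiating row i of X - A gives the i-th unit vector, and the resulting determinant is a
diagonal entry of the adjugate. -/
theorem derivative_charpoly {R n : Type*} [CommRing R] [Fintype n] [DecidableEq n]
    (A : Matrix n n R) : derivative A.charpoly = (adjugate (charmatrix A)).trace := by
  rw [Matrix.charpoly, derivative_det, Matrix.trace]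
  refine Finset.sum_congr rfl fun i _ => ?_
  rw [diag_apply, adjugate_apply]
  congr 2
  ext1 j
  by_cases h : i = j
  · subst h; simp [charmatrix_apply_eq]
  · simp [charmatrix_apply_ne _ _ _ h, Ne.symm h]

/-- Over a commutative algebra over a field of characteristic zero, a matrix all of whose powers
have trace zero is nilpotent. -/
theorem pow_card_eq_zero_of_trace_pow_eq_zero (F : Type*) {R n : Type*} [Field F] [CharZero F]
    [CommRing R] [Algebra F R] [Fintype n] [DecidableEq n] (A : Matrix n n R)
    (hA : ∀ j, (A ^ (j + 1)).trace = 0) : A ^ Fintype.card n = 0 := by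
  -- The adjugate of X - A as a polynomial with matrix coefficients; comparing coefficients in q·(X
  -- - A) = χ gives the recursion below.
  set q := matPolyEquiv (adjugate (charmatrix A)) with hq
  have hmul : q * (X - C A) = A.charpoly.map (algebraMap R (Matrix n n R)) := by
    rw [hq, ← matPolyEquiv_charmatrix, ← map_mul, adjugate_mul, ← Matrix.charpoly,
      matPolyEquiv_smul_one]
  have hsucc : ∀ k, q.coeff k = q.coeff (k + 1) * A + A.charpoly.coeff (k + 1) • 1 := by
    intro k
    have := congrArg (fun p => p.coeff (k + 1)) hmul
    simp only [mul_sub, coeff_sub, coeff_mul_X, coeff_mul_C, coeff_map,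
      Algebra.algebraMap_eq_smul_one] at this
    rw [← this]; abel
  have hzero : q.coeff 0 * A + A.charpoly.coeff 0 • 1 = 0 := by
    have := congrArg (fun p => p.coeff 0) hmul
    simp only [mul_sub, coeff_sub, coeff_mul_X_zero, coeff_mul_C, coeff_map,
      Algebra.algebraMap_eq_smul_one] at this
    rw [← this]; abel
  -- Descending induction on k, starting beyond the degree of q.
  have htr : ∀ r k j, q.natDegree < k + r → (q.coeff k * A ^ (j + 1)).trace = 0 := by
    intro r
    induction r with
    | zero => intro k j hk; rw [coeff_eq_zero_of_natDegree_lt (by omega)]; simp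
    | succ r ih =>
      intro k j hk
      rw [hsucc, add_mul, mul_assoc, ← pow_succ', trace_add, ih _ _ (by omega), smul_one_mul,
        trace_smul, hA]
      simp
  have htr1 : ∀ k, (q.coeff k * A).trace = 0 := fun k => by
    simpa using htr (q.natDegree + 1) k 0 (by omega)
  have hder : ∀ k, (q.coeff k).trace = A.charpoly.coeff (k + 1) * (k + 1) := by
    intro k
    rw [← coeff_derivative, derivative_charpoly, Matrix.trace, Matrix.trace, finsetSum_coeff]
    refine Finset.sum_congr rfl fun i _ => ?_
    rw [diag_apply, diag_apply, hq, matPolyEquiv_coeff_apply]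
  -- The recursion and the derivative of χ give two values of tr q_{k-1}; the case k = 0 uses the
  -- constant coefficient instead. In characteristic 0 only the leading coefficient of χ can
  -- survive.
  have hcoeff : ∀ k, A.charpoly.coeff k * k = A.charpoly.coeff k * Fintype.card n := by
    intro k
    cases k with
    | zero =>
      have := congrArg Matrix.trace hzero
      rw [trace_add, htr1, trace_smul, trace_one, trace_zero, zero_add, smul_eq_mul] at this
      rw [this]; simp
    | succ k =>
      have := hder k
      rw [hsucc, trace_add, htr1, trace_smul, trace_one, zero_add, smul_eq_mul] at this
      rw [this]; simp
  have hvanish : ∀ k, k ≠ Fintype.card n → A.charpoly.coeff k = 0 := by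
    intro k hk
    have h1 : ((k : F) - Fintype.card n) • A.charpoly.coeff k = 0 := by
      rw [Algebra.smul_def, map_sub, map_natCast, map_natCast, mul_comm, mul_sub, hcoeff, sub_self]
    refine (smul_eq_zero_iff_right ?_).1 h1
    rw [sub_ne_zero]
    exact_mod_cast hk
  rcases subsingleton_or_nontrivial R with hR | hR
  · exact Subsingleton.elim _ _
  have hX : A.charpoly = X ^ Fintype.card n := by
    ext k
    rw [coeff_X_pow]
    split_ifs with h
    · rw [h, ← charpoly_natDegree_eq_dim A]
      exact A.charpoly_monic
    · exact hvanish k h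
  have := aeval_self_charpoly A
  rwa [hX, map_pow, aeval_X] at this

end TraceNilpotent

/-! ### Matrices of odd elements of an exterior algebra -/

section Exterior

open ExteriorAlgebra

variable {F V : Type*} [Field F] [AddCommGroup V] [Module F V]

theorem ι_mul_ι_comm (x y : V) : ι F x * ι F y = -(ι F y * ι F x) :=
  eq_neg_of_add_eq_zero_left (ι_add_mul_swap x y)

/-- The subalgebra generated by the products of two vectors. -/
def evenPart (F V : Type*) [Field F] [AddCommGroup V] [Module F V] :
    Subalgebra F (ExteriorAlgebra F V) :=
  Algebra.adjoin F {a | ∃ x y, a = ι F x * ι F y}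

theorem commute_ι_of_mem_evenPart {a : ExteriorAlgebra F V} (ha : a ∈ evenPart F V) (x : V) :
    Commute (ι F x) a := by
  refine Algebra.commute_of_mem_adjoin_of_forall_mem_commute ha ?_
  rintro _ ⟨y, z, rfl⟩
  change _ * _ = _ * _
  rw [← mul_assoc, ι_mul_ι_comm x y, neg_mul, mul_assoc, ι_mul_ι_comm x z, mul_neg, neg_neg,
    mul_assoc]

theorem mul_comm_of_mem_evenPart {a b : ExteriorAlgebra F V} (ha : a ∈ evenPart F V)
    (hb : b ∈ evenPart F V) : a * b = b * a := by
  refine (Algebra.commute_of_mem_adjoin_of_forall_mem_commute ha ?_).symm.eq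
  rintro _ ⟨x, y, rfl⟩
  exact ((commute_ι_of_mem_evenPart hb x).mul_left (commute_ι_of_mem_evenPart hb y)).symm

/-- The nilpotency criterion needs commuting entries, which M² has although M does not. -/
noncomputable instance : CommRing (evenPart F V) :=
  { (inferInstance : Ring (evenPart F V)) with
    mul_comm := fun a b => Subtype.ext (mul_comm_of_mem_evenPart a.2 b.2) }

/-- A matrix of vectors, over the exterior algebra, is nilpotent of index twice its size. -/
theorem map_ι_pow_eq_zero [CharZero F] {n : Type*} [Fintype n] [DecidableEq n]
    (v : Matrix n n V) : (v.map (ι F)) ^ (2 * Fintype.card n) = 0 := by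
  set M := v.map (ι F) with hM
  let A : Matrix n n (evenPart F V) := Matrix.of fun i j =>
    ⟨(M * M) i j, by
      rw [Matrix.mul_apply]
      exact sum_mem fun k _ => Algebra.subset_adjoin ⟨v i k, v k j, rfl⟩⟩
  let φ : evenPart F V →+* ExteriorAlgebra F V := (evenPart F V).val.toRingHom
  have hA : φ.mapMatrix A = M * M := rfl
  have hpow : ∀ j, φ.mapMatrix (A ^ j) = M ^ (2 * j) := by
    intro j
    rw [map_pow, hA, ← pow_two, pow_mul]
  have htr : ∀ j, (A ^ (j + 1)).trace = 0 := by
    intro j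
    have h1 : φ (A ^ (j + 1)).trace = (M ^ (2 * (j + 1))).trace := by
      rw [← hpow]
      simp [Matrix.trace]
    have hanti : ∀ p q r s, (M ^ (2 * j) * M) p q * M r s = -(M r s * (M ^ (2 * j) * M) p q) := by
      intro p q r s
      rw [Matrix.mul_apply, Finset.sum_mul, Finset.mul_sum, ← Finset.sum_neg_distrib]
      refine Finset.sum_congr rfl fun k _ => ?_
      have hc : Commute (M r s) ((M ^ (2 * j)) p k) := by
        rw [← hpow]
        exact commute_ι_of_mem_evenPart ((A ^ j) p k).2 (v r s)
      rw [mul_assoc, hM, Matrix.map_apply, Matrix.map_apply, ι_mul_ι_comm, mul_neg, ← mul_assoc,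
        ← mul_assoc]
      congr 2
      exact hc.eq.symm
    -- Moving one factor M around the trace passes an odd element over an odd one, which costs a
    -- sign.
    have h2 : (M ^ (2 * (j + 1))).trace = -(M ^ (2 * (j + 1))).trace := by
      have e1 : M ^ (2 * (j + 1)) = M ^ (2 * j) * M * M := by
        rw [← pow_succ, ← pow_succ]; rfl
      have e2 : M ^ (2 * (j + 1)) = M * (M ^ (2 * j) * M) := by
        rw [← pow_succ, ← pow_succ']; rfl
      conv_lhs => rw [e1]
      conv_rhs => rw [e2]
      simp only [Matrix.trace, Matrix.diag_apply, Matrix.mul_apply (M := M ^ (2 * j) * M),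
        Matrix.mul_apply (M := M)]
      rw [Finset.sum_comm, ← Finset.sum_neg_distrib]
      refine Finset.sum_congr rfl fun p _ => ?_
      rw [← Finset.sum_neg_distrib]
      exact Finset.sum_congr rfl fun r _ => hanti _ _ _ _
    have h3 : (2 : F) • (M ^ (2 * (j + 1))).trace = 0 := by
      rw [two_smul]
      nth_rewrite 1 [h2]
      exact neg_add_cancel _
    rw [smul_eq_zero_iff_right two_ne_zero] at h3
    exact Subtype.ext (h1.trans h3)
  rw [← hpow, pow_card_eq_zero_of_trace_pow_eq_zero F A htr, map_zero]

end Exterior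

/-! ### The Amitsur-Levitzki theorem by Rosset's argument -/

section AmitsurLevitzki

open ExteriorAlgebra

theorem prod_ofFn_mul_of_commute {B : Type*} [Ring B] {m : ℕ} (x y : Fin m → B)
    (h : ∀ i j, Commute (x i) (y j)) :
    (List.ofFn fun i => x i * y i).prod = (List.ofFn x).prod * (List.ofFn y).prod := by
  induction m with
  | zero => simp
  | succ m ih =>
    rw [List.ofFn_succ, List.ofFn_succ, List.ofFn_succ, List.prod_cons, List.prod_cons,
      List.prod_cons, ih _ _ fun i j => h _ _]
    have hc : Commute (y 0) (List.ofFn fun i : Fin m => x i.succ).prod := by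
      refine (Commute.list_prod_left _ _ fun a ha => ?_).symm
      obtain ⟨i, rfl⟩ := List.mem_ofFn.1 ha
      exact h _ _
    simp only [mul_assoc]
    rw [← mul_assoc (y 0), hc.eq, mul_assoc]

/-- The standard polynomial as a power of a generic odd element. -/
theorem pow_sum_mul_eq_standard {A B F V : Type*} [Field F] [AddCommGroup V] [Module F V] [Ring A]
    [Ring B] {m : ℕ} (f : A →+* B) (g : ExteriorAlgebra F V →+* B)
    (hfg : ∀ a x, Commute (f a) (g x)) (a : Fin m → A) (e : Fin m → V) :
    (∑ i, f (a i) * g (ι F (e i))) ^ m = f (standard a) * g (ιMulti F m e) := by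
  have hexp : (∑ i, f (a i) * g (ι F (e i))) ^ m =
      ∑ r : Fin m → Fin m, f (List.ofFn fun l => a (r l)).prod * g (ιMulti F m (e ∘ r)) := by
    have := (MultilinearMap.mkPiAlgebraFin ℤ m B).map_sum
      (fun (_ : Fin m) (i : Fin m) => f (a i) * g (ι F (e i)))
    rw [MultilinearMap.mkPiAlgebraFin_apply, List.ofFn_const, List.prod_replicate] at this
    rw [this]
    refine Finset.sum_congr rfl fun r _ => ?_
    rw [MultilinearMap.mkPiAlgebraFin_apply,
      prod_ofFn_mul_of_commute (fun l => f (a (r l))) _ fun _ _ => hfg _ _, ιMulti_apply,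
      map_list_prod, map_list_prod, List.map_ofFn, List.map_ofFn]
    rfl
  rw [hexp, standard, map_sum, Finset.sum_mul]
  symm
  -- Only index maps that are permutations contribute, as a repeated vector kills the exterior
  -- product.
  refine Finset.sum_of_injOn (fun σ : Equiv.Perm (Fin m) => (σ : Fin m → Fin m)) ?_ ?_ ?_ ?_
  · exact fun σ _ σ' _ h => DFunLike.coe_injective h
  · exact fun σ _ => by simp
  · intro r _ hr
    rw [ιMulti_eq_zero_of_not_inj, map_zero, mul_zero]
    intro hinj
    refine hr ⟨Equiv.ofBijective r (Finite.injective_iff_bijective.1 hinj.of_comp), ?_, rfl⟩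
    simp
  · intro σ _
    rw [AlternatingMap.map_perm, Units.smul_def, map_zsmul, map_zsmul, smul_mul_assoc,
      mul_smul_comm]

/-- The determinant extends to a functional on the exterior algebra with value 1 on this element. -/
theorem ιMulti_single_ne_zero (F : Type*) [Field F] (m : ℕ) :
    ιMulti F m (fun i => (Pi.single i 1 : Fin m → F)) ≠ 0 := by
  intro h
  have := liftAlternating_apply_ιMulti (R := F) (N := F)
    (Pi.single m Matrix.detRowAlternating : ∀ i, (Fin m → F) [⋀^Fin i]→ₗ[F] F)
    (fun i => (Pi.single i 1 : Fin m → F))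
  rw [h, map_zero, Pi.single_eq_same] at this
  have h1 : Matrix.detRowAlternating (fun i => (Pi.single i 1 : Fin m → F)) = 1 := by
    have e : (Matrix.of fun i => (Pi.single i 1 : Fin m → F)) = 1 := by
      ext i j
      simp [Matrix.one_apply, Pi.single_apply, eq_comm]
    exact (congrArg Matrix.det e).trans Matrix.det_one
  rw [h1] at this
  exact zero_ne_one this

/-- The Amitsur-Levitzki theorem in characteristic zero. -/
theorem standard_matrix_eq_zero {F : Type*} [Field F] [CharZero F] {d : ℕ}
    (a : Fin (2 * d) → Matrix (Fin d) (Fin d) F) : standard a = 0 := by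
  let V := Fin (2 * d) → F
  let f : Matrix (Fin d) (Fin d) F →+* Matrix (Fin d) (Fin d) (ExteriorAlgebra F V) :=
    (algebraMap F (ExteriorAlgebra F V)).mapMatrix
  let g : ExteriorAlgebra F V →+* Matrix (Fin d) (Fin d) (ExteriorAlgebra F V) :=
    Matrix.scalar (Fin d)
  have hfg : ∀ b x, Commute (f b) (g x) := by
    intro b x
    ext i j
    simp [f, g, Algebra.commutes]
  -- Rosset's matrix ∑ a_i e_i, seen as a matrix of vectors.
  have hM : ∑ i, f (a i) * g (ι F (Pi.single i 1 : V)) =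
      (Matrix.of fun p q => (fun i => a i p q : V)).map (ι F) := by
    ext p q
    simp only [Matrix.sum_apply, Matrix.map_apply, Matrix.of_apply]
    conv_rhs => rw [pi_eq_sum_univ (fun i => a i p q : V), map_sum]
    refine Finset.sum_congr rfl fun i _ => ?_
    have hs : (fun j => if i = j then (1 : F) else 0) = (Pi.single i 1 : V) := by
      ext j
      simp [Pi.single_apply, eq_comm]
    rw [hs, LinearMap.map_smul, Algebra.smul_def]
    simp only [f, g, RingHom.mapMatrix_apply, Matrix.scalar_apply, Matrix.mul_diagonal,
      Matrix.map_apply]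
  have hpow := map_ι_pow_eq_zero (F := F) (Matrix.of fun p q => (fun i => a i p q : V))
  rw [← hM, Fintype.card_fin, pow_sum_mul_eq_standard f g hfg] at hpow
  ext p q
  have := congrFun₂ hpow p q
  simp only [f, g, RingHom.mapMatrix_apply, Matrix.scalar_apply, Matrix.mul_diagonal,
    Matrix.map_apply, ← Algebra.smul_def, Matrix.zero_apply] at this
  exact (smul_eq_zero.1 this).resolve_right (ιMulti_single_ne_zero F (2 * d))

end AmitsurLevitzki


/-! ### Finiteness, constants and the main theorem -/

section Main

variable {F : Type*} [Field F]

theorem IsSPolynomial.isIdentity [CharZero F] {d n : ℕ} {P : NCPoly F}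
    (hP : IsSPolynomial d n P) : IsIdentity (Matrix (Fin d) (Fin d) F) P := by
  obtain ⟨c, -, rfl⟩ := hP
  intro a
  rw [map_sum]
  refine Finset.sum_eq_zero fun j _ => ?_
  rw [map_smul, map_standard, standard_matrix_eq_zero, smul_zero]

theorem isIdentity_combine {A : Type*} [Ring A] [Algebra F A] {n : ℕ} {P : Fin n → NCPoly F}
    (z : Fin n → ℕ) (hP : ∀ i, IsIdentity A (P i)) : IsIdentity A (combine z P) := by
  intro a
  rw [combine, map_sum]
  exact Finset.sum_eq_zero fun i _ => by rw [map_mul, hP i a, mul_zero]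

theorem exists_generatedBy {d n : ℕ} {I : Type*} {P : I → NCPoly F}
    (hP : ∀ i, IsSPolynomial d n (P i)) : ∃ k, GeneratedBy {standardPoly F (2 * d)} P k := by
  refine ⟨_, generatedBy_of_fintype
    (fun (J : Fin (2 * d) → Fin n) l => var F (J l : ℕ)) fun i => ?_⟩
  obtain ⟨c, -, hc⟩ := hP i
  rw [hc]
  refine sum_mem fun J _ => smul_mem_twoSidedIdeal ?_ _
  exact TwoSidedIdeal.subset_span ⟨J, rfl⟩

theorem GeneratedBy.combine {m n k : ℕ} {P : Fin n → NCPoly F} (z : Fin n → ℕ)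
    (h : GeneratedBy {standardPoly F m} P k) :
    GeneratedBy {standardPoly F m} (fun _ : Unit => combine z P) k := by
  obtain ⟨g, hg, hP⟩ := h
  exact ⟨g, hg, fun _ => sum_mem fun i _ => TwoSidedIdeal.mul_mem_left _ _ _ (hP i)⟩

theorem Q_ne_top_of_generatedBy {m k : ℕ} {I : Type*} {f : I → NCPoly F}
    (h : GeneratedBy {standardPoly F m} f k) : Q {standardPoly F m} f ≠ ⊤ :=
  ne_top_of_le_ne_top (ENat.natCast_ne_top k) (Q_le_iff_generatedBy.2 h)

theorem generatedBy_toNat_Q {m : ℕ} {I : Type*} {f : I → NCPoly F}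
    (h : Q {standardPoly F m} f ≠ ⊤) :
    GeneratedBy {standardPoly F m} f (Q {standardPoly F m} f).toNat :=
  Q_le_iff_generatedBy.1 (ENat.natCast_toNat h).ge

/-- For 2r ≤ n each of the r factors of the falling factorial is at least n/2. -/
theorem pow_le_mul_choose {r n : ℕ} (h : 2 * r ≤ n) : n ^ r ≤ 2 ^ r * r.factorial * n.choose r := by
  have h1 : n ^ r ≤ (2 * (n + 1 - r)) ^ r := by gcongr; omega
  rw [mul_pow] at h1
  have h2 := Nat.pow_sub_le_descFactorial n r
  rw [Nat.descFactorial_eq_factorial_mul_choose] at h2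
  calc n ^ r ≤ 2 ^ r * (n + 1 - r) ^ r := h1
    _ ≤ 2 ^ r * (r.factorial * n.choose r) := by gcongr
    _ = _ := by ring

theorem exists_hard_family (d : ℕ) (hd : 1 ≤ d) : ∃ K : ℕ, 0 < K ∧
    ∀ (F : Type*) [Field F] (n : ℕ), 4 * d ≤ n → ∃ P : Fin n → NCPoly F,
      (∀ i, IsSPolynomial d n (P i)) ∧
      (∀ k, GeneratedBy {standardPoly F (2 * d)} P k → n ^ (2 * d) ≤ K * k) ∧
      ∀ z, IsNewVars n z → ∀ k,
        GeneratedBy {standardPoly F (2 * d)} (fun _ : Unit => combine z P) k →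
          n ^ (2 * d) ≤ K * k := by
  obtain ⟨B, hB, hhard⟩ := exists_sFamily_hard d
  refine ⟨2 ^ (2 * d) * (2 * d).factorial * B * (2 * d + 1), by positivity, fun F _ n hn => ?_⟩
  obtain ⟨s, hs⟩ := hhard F n (by omega)
  have hP : ∀ i, IsSPolynomial d n (sFamily F d n s i) := isSPolynomial_sFamily s
  have hlow : ∀ k, GeneratedBy {standardPoly F (2 * d)} (sFamily F d n s) k →
      n ^ (2 * d) ≤ 2 ^ (2 * d) * (2 * d).factorial * (B * k) := fun k hk =>
    (pow_le_mul_choose (by omega)).trans (Nat.mul_le_mul_left _ (hs k hk))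
  refine ⟨sFamily F d n s, hP, fun k hk => (hlow k hk).trans ?_, fun z hz k hk => ?_⟩
  · rw [← mul_assoc]
    exact Nat.mul_le_mul_right _ (Nat.le_mul_of_pos_right _ (by omega))
  · refine (hlow _ (generatedBy_of_combine hd hP hz hk)).trans (le_of_eq ?_)
    ring

end Main

end GenComplexity

open GenComplexity in
theorem mainTheorem3 (d : ℕ) (hd : 1 ≤ d) :
    -- the single polynomial `∑ z_i P_i` is almost as hard as the sequence `P_1, …, P_n`
    (∀ (F : Type*) [Field F] (n : ℕ) (P : Fin n → NCPoly F) (z : Fin n → ℕ),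
      (∀ i, IsSPolynomial d n (P i)) → IsNewVars n z →
        Q {standardPoly F (2 * d)} P ≤
          ((2 * d + 1 : ℕ) : ℕ∞) * Q₁ {standardPoly F (2 * d)} (combine z P)) ∧
    -- the lower bounds; `c` and `N` depend on `d` only
    ∃ c : ℝ, 0 < c ∧ ∃ N : ℕ, ∀ (F : Type*) [Field F] [CharZero F] (n : ℕ), N ≤ n →
      (∃ P : Fin n → NCPoly F,
        (∀ i, IsSPolynomial d n (P i)) ∧
        (∀ i, IsIdentity (Matrix (Fin d) (Fin d) F) (P i)) ∧
        Q {standardPoly F (2 * d)} P ≠ ⊤ ∧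
        c * (n : ℝ) ^ (2 * d) ≤ ((Q {standardPoly F (2 * d)} P).toNat : ℝ) ∧
        ∀ z : Fin n → ℕ, IsNewVars n z →
          Q₁ {standardPoly F (2 * d)} (combine z P) ≠ ⊤ ∧
          c * (n : ℝ) ^ (2 * d) ≤
            ((Q₁ {standardPoly F (2 * d)} (combine z P)).toNat : ℝ)) ∧
      -- the same for `n` as the total number of variables of `∑ z_i P_i`
      (∃ (m : ℕ) (P : Fin m → NCPoly F) (z : Fin m → ℕ),
        (∀ i, IsSPolynomial d m (P i)) ∧ IsNewVars m z ∧ (∀ i, z i < n) ∧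
        IsIdentity (Matrix (Fin d) (Fin d) F) (combine z P) ∧
        Q₁ {standardPoly F (2 * d)} (combine z P) ≠ ⊤ ∧
        c * (n : ℝ) ^ (2 * d) ≤
          ((Q₁ {standardPoly F (2 * d)} (combine z P)).toNat : ℝ)) := by
  refine ⟨fun F _ n P z hP hz => Q_le_mul_Q_combine hd hP hz, ?_⟩
  obtain ⟨K, hK, hhard⟩ := exists_hard_family d hd
  -- One constant serves both claims: m = n in (a) and m = ⌊n/2⌋ in (b), where n ≤ 3⌊n/2⌋ for n ≥ 2.
  have hbound : ∀ m n k : ℕ, n ≤ 3 * m → m ^ (2 * d) ≤ K * k →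
      ((K * 3 ^ (2 * d) : ℕ) : ℝ)⁻¹ * (n : ℝ) ^ (2 * d) ≤ k := by
    intro m n k hmn hk
    rw [inv_mul_le_iff₀ (by positivity)]
    have : n ^ (2 * d) ≤ K * 3 ^ (2 * d) * k :=
      calc n ^ (2 * d) ≤ (3 * m) ^ (2 * d) := by gcongr
        _ = 3 ^ (2 * d) * m ^ (2 * d) := mul_pow _ _ _
        _ ≤ 3 ^ (2 * d) * (K * k) := by gcongr
        _ = _ := by ring
    exact_mod_cast this
  -- The bound n ≥ 8d ensures ⌊n/2⌋ ≥ 4d, as the hard family requires.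
  refine ⟨((K * 3 ^ (2 * d) : ℕ) : ℝ)⁻¹, by positivity, 8 * d, fun F _ _ n hn => ⟨?_, ?_⟩⟩
  · obtain ⟨P, hP, hQ, hQz⟩ := hhard F n (by omega)
    obtain ⟨k, hk⟩ := exists_generatedBy hP
    have hne := Q_ne_top_of_generatedBy hk
    refine ⟨P, hP, fun i => (hP i).isIdentity, hne,
      hbound n n _ (by omega) (hQ _ (generatedBy_toNat_Q hne)), fun z hz => ?_⟩
    have hnez := Q_ne_top_of_generatedBy (hk.combine z)
    exact ⟨hnez, hbound n n _ (by omega) (hQz z hz _ (generatedBy_toNat_Q hnez))⟩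
  · obtain ⟨P, hP, -, hQz⟩ := hhard F (n / 2) (by omega)
    obtain ⟨k, hk⟩ := exists_generatedBy hP
    -- Half of the n variables serve for the P_i, the other half as multipliers.
    let z : Fin (n / 2) → ℕ := fun i => n / 2 + i
    have hz : IsNewVars (n / 2) z :=
      ⟨fun i j h => Fin.ext (Nat.add_left_cancel h), fun i => Nat.le_add_right _ _⟩
    have hnez := Q_ne_top_of_generatedBy (hk.combine z)
    refine ⟨n / 2, P, z, hP, hz, fun i => ?_, isIdentity_combine z fun i => (hP i).isIdentity,
      hnez, hbound (n / 2) n _ (by omega) (hQz z hz _ (generatedBy_toNat_Q hnez))⟩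
    have := i.2
    simp only [z]
    omega
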